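/- **Model.** There are finitely many resource types $k\in\mathcal K$, each with capacity $1$ and the same supply cost function $f:[0,1]\to\mathbb R$, which is increasing, differentiable (one-sidedly at $0$ and $1$), strictly convex, and satisfies $f(0)=0$. Put $\underline c=f'(0)$, $\overline c=f'(1)$, let $f'^{-1}:[\underline c,\overline c]\to[0,1]$ be the inverse of $f'$, and let $\overline p>\underline c$. A finite set $\mathcal B\subset\mathbb R_{\ge 0}^{\mathcal K}$ of bundle shapes with $\emptyset:=0\in\mathcal B$ is given; at demand scale $\varepsilon>0$ the bundle of shape $b$ contains $r^b_k=\varepsilon b_k$ units of resource $k$. An arrival instance consists of $N$ customers arriving in sequence, with valuations $v_n:\mathcal B\to\mathbb R$ such that $v_n(\emptyset)=0$ and $v_n(b)/r_k^b\le\overline p$ whenever $r_k^b\ne 0$. An allocation $(b_n)_{n\le N}$ is feasible if its total demand $y_k=\sum_n r_k^{b_n}$ is at most $1$ for every $k$; its social welfare is $\sum_n v_n(b_n)-\sum_k f(y_k)$. The optimal offline welfare $W_{\rm opt}$ is the maximum over feasible allocations. An online algorithm chooses $b_n$ as a function of $v_1,\dots,v_n$ (and of the setup, including $\varepsilon$).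 Given a pricing function $\phi:[0,1]\to\mathbb R$, the posted-price mechanism $\mathrm{PPM}_\phi$ offers customer $n$ each resource $k$ at unit price $\phi(y_k)$, where $y_k$ is its current utilization; the customer picks a bundle $b_*$ maximizing $v_n(b)-\sum_k\phi(y_k)r_k^b$ (ties broken arbitrarily) and receives it, unless its utility is negative or $y_k+r_k^{b_*}>1$ for some $k$, in which case she receives $\emptyset$. For $\alpha\ge1$, a mechanism is $\alpha$-competitive (for infinitesimal demands) if for every $\delta>0$ there is $\varepsilon_0>0$ such that for all $0<\varepsilon<\varepsilon_0$ and all arrival instances at scale $\varepsilon$, each of its outcomes is feasible and has welfare at least $\frac1\alpha W_{\rm opt}-\delta$. **Theorem.** Let $\alpha\ge1$. Solutions of the boundary value problems below are understood to be continuous up to the end points of the intervals, with $\phi>\underline c$ in the open intervals of $\mathsf L(\alpha)$ and $\mathsf H_1(u,\alpha)$. *Low uncertainty, $\overline p\le\overline c$.* Let $v=f'^{-1}(\overline p)$ and consider $$\mathsf L(\alpha):\quad \phi'(y)=\alpha\,\frac{\phi(y)-f'(y)}{f'^{-1}(\phi(y))},\ y\in(0,v),\qquad \phi(0)=\underline c,\quad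 \phi(v)\ge\overline p,$$ where the differential equation is required at those $y$ with $\phi(y)\le\overline c$, so that $f'^{-1}(\phi(y))$ is defined. (a) If $\phi:[0,1]\to\mathbb R$ is strictly increasing and solves $\mathsf L(\alpha)$, then $\mathrm{PPM}_\phi$ is $\alpha$-competitive. (b) Suppose that $\mathcal B$ contains a bundle consisting of a positive amount of a single resource. If there is an $\alpha$-competitive online algorithm, then there is a strictly increasing $\phi:[0,1]\to\mathbb R$ that solves $\mathsf L(\alpha)$ and satisfies $\phi\le\overline c$ on $(0,v)$ (so that the equation holds on all of $(0,v)$). *High uncertainty, $\overline p>\overline c$.* For $u\in(0,1)$ consider $$\mathsf H_1(u,\alpha):\quad \phi'(y)=\alpha\,\frac{\phi(y)-f'(y)}{f'^{-1}(\phi(y))},\ y\in(0,u),\qquad \phi(0)=\underline c,\quad\phi(u)=\overline c,$$ $$\mathsf H_2(u,\alpha):\quad \phi'(y)=\alpha\,(\phi(y)-f'(y)),\ y\in(u,1),\qquad \phi(u)=\overline c,\quad\phi(1)\ge\overline p,$$ where in $\mathsf H_1(u,\alpha)$ also $\phi\le\overline c$ on $(0,u)$. (a) If $u\in(0,1)$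 and $\phi$ solves $\mathsf H_1(u,\alpha)$ and $\mathsf H_2(u,\alpha)$, then $\mathrm{PPM}_\phi$ is $\alpha$-competitive. (b) Suppose that $\mathcal B$ contains a bundle consisting of a positive amount of a single resource. If there is an $\alpha$-competitive online algorithm, then there are $u\in(0,1)$ and a strictly increasing $\phi:[0,1]\to\mathbb R$ that solves both $\mathsf H_1(u,\alpha)$ and $\mathsf H_2(u,\alpha)$. -/

import Mathlib

open Set

noncomputable section

/-! ### The setup -/

/-- A setup: finitely many resource types `K` (each of unit capacity), a common supply cost `f`,
a finite set of bundle shapes containing the empty bundle, and the upper bound `pbar` on the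
per-unit valuations. A bundle is the vector of its demands. -/
structure Setup (K : Type*) where
  f : ℝ → ℝ
  pbar : ℝ
  bundles : Finset (K → ℝ)
  f_zero : f 0 = 0
  f_diff : DifferentiableOn ℝ f (Icc 0 1)
  f_strictConvex : StrictConvexOn ℝ (Icc 0 1) f
  f_mono : MonotoneOn f (Icc 0 1)
  empty_mem : (0 : K → ℝ) ∈ bundles
  demand_nonneg : ∀ b ∈ bundles, ∀ k, 0 ≤ b k
  lt_pbar : derivWithin f (Icc 0 1) 0 < pbar

namespace Setup

variable {K : Type*} (S : Setup K)

/-- The marginal cost `f'` on `[0,1]` (one-sided at the end points). -/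
def marginal (y : ℝ) : ℝ := derivWithin S.f (Icc 0 1) y

/-- The minimum marginal cost `f'(0)`. -/
def cLow : ℝ := S.marginal 0

/-- The maximum marginal cost `f'(1)`. -/
def cHigh : ℝ := S.marginal 1

/-- The inverse of `f'`, meaningful on `[f'(0), f'(1)]`, with values in `[0,1]`. -/
def marginalInv (p : ℝ) : ℝ := Function.invFunOn S.marginal (Icc 0 1) p

/-- The available bundles. -/
abbrev Bundle : Type _ := {b : K → ℝ // b ∈ S.bundles}

/-- The empty bundle. -/
def emptyBundle : S.Bundle := ⟨0, S.empty_mem⟩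

/-- A valuation function of a customer. -/
abbrev Valuation : Type _ := S.Bundle → ℝ

/-! ### The market at demand scale `ε`

At scale `ε > 0` the bundle of shape `b` consists of `ε * b k` units of each resource `k`. Small
demands are modelled by letting `ε` tend to `0`. An arrival instance consists of `N` customers
`0, …, N - 1`, in the order of arrival, and their valuation functions `v 0, …, v (N - 1)`. -/

/-- The number of units of resource `k` in bundle `b` at scale `ε`. -/
def demand (ε : ℝ) (b : S.Bundle) (k : K) : ℝ := ε * b.1 k

/-- Arrival instances: the empty bundle is worth `0`, and the value of a bundle per unit of any
resource in it is at most `pbar`. -/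
def IsInstance (ε : ℝ) (N : ℕ) (v : ℕ → S.Valuation) : Prop :=
  ∀ n < N, v n S.emptyBundle = 0 ∧
    ∀ (b : S.Bundle) (k : K), S.demand ε b k ≠ 0 → v n b / S.demand ε b k ≤ S.pbar

/-- Utilization of resource `k` after the customers before `n` are processed, when customer `i`
gets the bundle `a i`. -/
def utilization (ε : ℝ) (a : ℕ → S.Bundle) (n : ℕ) (k : K) : ℝ :=
  ∑ i ∈ Finset.range n, S.demand ε (a i) k

/-- The allocation `a` to `N` customers respects the unit capacities. -/
def Feasible (ε : ℝ) (N : ℕ) (a : ℕ → S.Bundle) : Prop :=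
  ∀ k, S.utilization ε a N k ∈ Icc (0 : ℝ) 1

section Welfare

variable [Fintype K]

/-- Social welfare: total valuation minus total supply cost. -/
def welfare (ε : ℝ) (N : ℕ) (v : ℕ → S.Valuation) (a : ℕ → S.Bundle) : ℝ :=
  ∑ n ∈ Finset.range N, v n (a n) - ∑ k, S.f (S.utilization ε a N k)

/-- Optimal offline social welfare. The set below is finite and nonempty. -/
def optWelfare (ε : ℝ) (N : ℕ) (v : ℕ → S.Valuation) : ℝ :=
  sSup {w | ∃ a : ℕ → S.Bundle, S.Feasible ε N a ∧ w = S.welfare ε N v a}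

/-- A mechanism is represented by the relation `M ε N v a`: at scale `ε`, on the instance `(N, v)`,
`a` is a possible resulting allocation. It is `α`-competitive for infinitesimal demands if,
for all sufficiently small scales, on every instance it has an outcome, and every outcome is
feasible and its welfare is at least `1/α` times the offline optimum, up to an error that is
uniform in the instance and vanishes with the scale. -/
def IsCompetitive (α : ℝ) (M : ℝ → ℕ → (ℕ → S.Valuation) → (ℕ → S.Bundle) → Prop) : Prop :=
  ∀ δ > 0, ∃ ε₀ > 0, ∀ ε, 0 < ε → ε < ε₀ → ∀ (N : ℕ) (v : ℕ → S.Valuation),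
    S.IsInstance ε N v →
      (∃ a, M ε N v a) ∧
      ∀ a, M ε N v a → S.Feasible ε N a ∧
        1 / α * S.optWelfare ε N v - δ ≤ S.welfare ε N v a

/-- Utility of a customer with valuation `w` for bundle `b` at posted unit prices `p`. -/
def utility (ε : ℝ) (w : S.Valuation) (p : K → ℝ) (b : S.Bundle) : ℝ :=
  w b - ∑ k, p k * S.demand ε b k

/-- The posted-price mechanism with pricing function `φ`: customer `n` is offered resource `k` at
the unit price `φ` of its current utilization, picks a utility-maximizing bundle (ties are broken
arbitrarily), and leaves with nothing if the utility is negative or the bundle does not fit. -/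
def PPM (φ : ℝ → ℝ) (ε : ℝ) (N : ℕ) (v : ℕ → S.Valuation) (a : ℕ → S.Bundle) : Prop :=
  ∀ n < N, ∃ b : S.Bundle,
    (∀ b', S.utility ε (v n) (fun k => φ (S.utilization ε a n k)) b' ≤
      S.utility ε (v n) (fun k => φ (S.utilization ε a n k)) b) ∧
    (((S.utility ε (v n) (fun k => φ (S.utilization ε a n k)) b < 0 ∨
        ∃ k, 1 < S.utilization ε a n k + S.demand ε b k) ∧ a n = S.emptyBundle) ∨
     (¬ (S.utility ε (v n) (fun k => φ (S.utilization ε a n k)) b < 0 ∨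
        ∃ k, 1 < S.utilization ε a n k + S.demand ε b k) ∧ a n = b))

/-- An online algorithm decides on the bundle of customer `n` from the valuation functions of the
customers `0, …, n`; the scale is part of the setup and known to it. -/
abbrev OnlineAlgorithm : Type _ := (ε : ℝ) → (n : ℕ) → (Fin (n + 1) → S.Valuation) → S.Bundle

/-- The outcome of an online algorithm. -/
def OnlineAlgorithm.run {S : Setup K} (A : S.OnlineAlgorithm)
    (ε : ℝ) (N : ℕ) (v : ℕ → S.Valuation) (a : ℕ → S.Bundle) : Prop :=
  ∀ n < N, a n = A ε n (fun i => v i)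

end Welfare

/-! ### The boundary value problems -/

/-- `φ` solves the problem `L(α)` on `[0, v]`, `v = f'⁻¹(pbar)`. The differential equation is
required wherever `f'⁻¹(φ y)` is defined and nonzero; `φ y > f'(0)` is required on `(0, v)`. -/
structure SolvesL (α : ℝ) (φ : ℝ → ℝ) : Prop where
  cont : ContinuousOn φ (Icc 0 (S.marginalInv S.pbar))
  low : ∀ y ∈ Ioo 0 (S.marginalInv S.pbar), S.cLow < φ y
  ode : ∀ y ∈ Ioo 0 (S.marginalInv S.pbar), φ y ≤ S.cHigh →
    HasDerivAt φ (α * ((φ y - S.marginal y) / S.marginalInv (φ y))) y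
  left : φ 0 = S.cLow
  right : S.pbar ≤ φ (S.marginalInv S.pbar)

/-- `φ` solves the problem `H₁(u, α)`; on `(0, u)` the quotient has to be defined. -/
structure SolvesH1 (u α : ℝ) (φ : ℝ → ℝ) : Prop where
  cont : ContinuousOn φ (Icc 0 u)
  range : ∀ y ∈ Ioo 0 u, φ y ∈ Ioc S.cLow S.cHigh
  ode : ∀ y ∈ Ioo 0 u,
    HasDerivAt φ (α * ((φ y - S.marginal y) / S.marginalInv (φ y))) y
  left : φ 0 = S.cLow
  right : φ u = S.cHigh

/-- `φ` solves the problem `H₂(u, α)`. -/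
structure SolvesH2 (u α : ℝ) (φ : ℝ → ℝ) : Prop where
  cont : ContinuousOn φ (Icc u 1)
  ode : ∀ y ∈ Ioo u 1, HasDerivAt φ (α * (φ y - S.marginal y)) y
  left : φ u = S.cHigh
  right : S.pbar ≤ φ 1

/-- Some resource can be bought on its own. -/
def HasSingleResourceBundle : Prop :=
  ∃ b ∈ S.bundles, ∃ k, 0 < b k ∧ ∀ j, j ≠ k → b j = 0

end Setup

end

section

open Filter Topology

/-! Let `conj` be the convex conjugate of `f` and `supply` its derivative: `f'⁻¹`, extended by
clamping, so equal to `1` above `cHigh`. With `supply` for `f'⁻¹`, all three differential equations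
become one, and it says exactly that `f y + conj (φ y) / α` has derivative `φ y`: revenue pays for
the supply cost plus a `1 / α` share of the dual cost of the current price.

Sufficiency is a primal-dual argument. Weak duality at the final prices, capped at `pbar`, bounds
the optimum by the customers' utilities plus the sum of `conj` over resources. The mechanism earns
those utilities plus its revenue minus cost, so the identity gives the ratio (`potential_sub_le`,
`isCompetitive_PPM`). Finite demands cause only errors vanishing with `ε`: revenue is a left Riemann
sum, and a desired bundle may fail to fit (`potential_step`, `purchase_spec`).

Necessity: offer one single-resource bundle to large groups of customers whose unit value climbs
from `cLow` to `pbar`. Stopping after any group forces the sales `s` to satisfy a discrete form of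
`profit p (s p) - ∫ s ≥ conj p / α`, the integral running over prices below `p`
(`exists_sales_of_isCompetitive`). For the inverse `ψ` of a pricing function the differential
equation is the corresponding equality. It is solved backwards from the largest possible end value
`ψ pbar = supply pbar`; comparison with the sales keeps this solution alive down to `cLow`, with
errors that do not accumulate (`exists_backward_scheme`). A limit of the schemes solves the integral
equation (`exists_isIntegralSolution`). Squeezed between `0` and `supply`, it vanishes at `cLow`; it
is differentiable and strictly increasing, and its inverse is the required `φ`
(`IsIntegralSolution.exists_pricing`). -/

theorem MonotoneOn.continuousOn_Icc_of_surjOn {g : ℝ → ℝ} {c d : ℝ} (hg : MonotoneOn g (Icc c d))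
    (hs : SurjOn g (Icc c d) (Icc (g c) (g d))) : ContinuousOn g (Icc c d) := by
  rcases le_or_gt c d with hcd | hcd
  · have hmaps : ∀ x : Icc c d, g x ∈ Icc (g c) (g d) := fun x =>
      ⟨hg (left_mem_Icc.2 hcd) x.2 x.2.1, hg x.2 (right_mem_Icc.2 hcd) x.2.2⟩
    let G : Icc c d → Icc (g c) (g d) := fun x => ⟨g x, hmaps x⟩
    have hG : Monotone G := fun x y hxy => hg x.2 y.2 hxy
    have hGs : Function.Surjective G := by
      rintro ⟨y, hy⟩
      obtain ⟨x, hx, rfl⟩ := hs hy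
      exact ⟨⟨x, hx⟩, rfl⟩
    rw [continuousOn_iff_continuous_domRestrict]
    exact continuous_subtype_val.comp (hG.continuous_of_surjective hGs)
  · simp [Icc_eq_empty_of_lt hcd]

/-- The inverse of a strictly increasing function mapping `[a, b]` onto `[f a, f b]`. -/
theorem StrictMonoOn.invFunOn_Icc {f : ℝ → ℝ} {a b : ℝ} (hab : a ≤ b)
    (hf : StrictMonoOn f (Icc a b)) (hs : SurjOn f (Icc a b) (Icc (f a) (f b))) :
    StrictMonoOn (Function.invFunOn f (Icc a b)) (Icc (f a) (f b)) ∧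
    ContinuousOn (Function.invFunOn f (Icc a b)) (Icc (f a) (f b)) ∧
    (∀ y ∈ Icc (f a) (f b), Function.invFunOn f (Icc a b) y ∈ Icc a b ∧
      f (Function.invFunOn f (Icc a b) y) = y) ∧
    (∀ x ∈ Icc a b, Function.invFunOn f (Icc a b) (f x) = x) := by
  have h1 : ∀ y ∈ Icc (f a) (f b), Function.invFunOn f (Icc a b) y ∈ Icc a b ∧
      f (Function.invFunOn f (Icc a b) y) = y := fun y hy => Function.invFunOn_pos (hs hy)
  have h2 : ∀ x ∈ Icc a b, Function.invFunOn f (Icc a b) (f x) = x := fun x hx =>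
    hf.injOn.leftInvOn_invFunOn hx
  have ha := left_mem_Icc.2 hab
  have hb := right_mem_Icc.2 hab
  have h3 : StrictMonoOn (Function.invFunOn f (Icc a b)) (Icc (f a) (f b)) := by
    intro x hx y hy hxy
    rw [← hf.lt_iff_lt (h1 x hx).1 (h1 y hy).1, (h1 x hx).2, (h1 y hy).2]
    exact hxy
  refine ⟨h3, h3.monotoneOn.continuousOn_Icc_of_surjOn ?_, h1, h2⟩
  intro x hx
  rw [h2 a ha, h2 b hb] at hx
  exact ⟨f x, ⟨hf.monotoneOn ha hx hx.1, hf.monotoneOn hx hb hx.2⟩, h2 x hx⟩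

/-! ### Marginal cost, supply and the convex conjugate of the cost. -/

namespace Setup

variable {K : Type*} (S : Setup K)

theorem strictMonoOn_marginal : StrictMonoOn S.marginal (Icc 0 1) :=
  S.f_strictConvex.strictMonoOn_derivWithin S.f_diff

theorem hasDerivWithinAt_marginal {y : ℝ} (hy : y ∈ Icc (0 : ℝ) 1) :
    HasDerivWithinAt S.f (S.marginal y) (Icc 0 1) y :=
  (S.f_diff y hy).hasDerivWithinAt

theorem hasDerivAt_marginal {y : ℝ} (hy : y ∈ Ioo (0 : ℝ) 1) :
    HasDerivAt S.f (S.marginal y) y :=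
  (S.hasDerivWithinAt_marginal (Ioo_subset_Icc_self hy)).hasDerivAt (Icc_mem_nhds hy.1 hy.2)

theorem continuousOn_f : ContinuousOn S.f (Icc 0 1) := S.f_diff.continuousOn

theorem zero_mem : (0 : ℝ) ∈ Icc (0 : ℝ) 1 := ⟨le_rfl, zero_le_one⟩
theorem one_mem : (1 : ℝ) ∈ Icc (0 : ℝ) 1 := ⟨zero_le_one, le_rfl⟩

theorem f_nonneg {y : ℝ} (hy : y ∈ Icc (0 : ℝ) 1) : 0 ≤ S.f y := by
  have := S.f_mono zero_mem hy hy.1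
  rwa [S.f_zero] at this

theorem cLow_nonneg : 0 ≤ S.cLow := S.f_mono.derivWithin_nonneg

theorem cLow_lt_cHigh : S.cLow < S.cHigh := S.strictMonoOn_marginal zero_mem one_mem one_pos

theorem cLow_lt_pbar : S.cLow < S.pbar := S.lt_pbar

/-- Darboux's theorem: derivatives have the intermediate value property, so continuity of `f'` need
not be assumed. -/
theorem surjOn_marginal : SurjOn S.marginal (Icc 0 1) (Icc (S.marginal 0) (S.marginal 1)) := by
  have h := ordConnected_Icc.image_hasDerivWithinAt (f := S.f) (f' := S.marginal)
    (s := Icc (0 : ℝ) 1) (fun x hx => S.hasDerivWithinAt_marginal hx)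
  exact h.out (mem_image_of_mem _ zero_mem) (mem_image_of_mem _ one_mem)

theorem marginalInv_spec :
    StrictMonoOn S.marginalInv (Icc S.cLow S.cHigh) ∧
    ContinuousOn S.marginalInv (Icc S.cLow S.cHigh) ∧
    (∀ p ∈ Icc S.cLow S.cHigh, S.marginalInv p ∈ Icc (0 : ℝ) 1 ∧
      S.marginal (S.marginalInv p) = p) ∧
    (∀ y ∈ Icc (0 : ℝ) 1, S.marginalInv (S.marginal y) = y) :=
  S.strictMonoOn_marginal.invFunOn_Icc zero_le_one S.surjOn_marginal

/-- The utilization maximizing the profit `p * y - f y` over `[0, 1]`. -/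
noncomputable def supply (p : ℝ) : ℝ := S.marginalInv (max S.cLow (min p S.cHigh))

/-- The profit at unit price `p` and utilization `y`. -/
def profit (p y : ℝ) : ℝ := p * y - S.f y

/-- The maximal profit at unit price `p`, that is, the convex conjugate of the cost function. -/
noncomputable def conj (p : ℝ) : ℝ := S.profit p (S.supply p)

theorem clamp_mem (p : ℝ) : max S.cLow (min p S.cHigh) ∈ Icc S.cLow S.cHigh :=
  ⟨le_max_left _ _, max_le S.cLow_lt_cHigh.le (min_le_right _ _)⟩

theorem supply_mem (p : ℝ) : S.supply p ∈ Icc (0 : ℝ) 1 :=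
  (S.marginalInv_spec.2.2.1 _ (S.clamp_mem p)).1

theorem continuous_supply : Continuous S.supply := by
  have h : Continuous fun p : ℝ => max S.cLow (min p S.cHigh) := by fun_prop
  exact S.marginalInv_spec.2.1.comp_continuous h S.clamp_mem

theorem monotone_supply : Monotone S.supply := fun p q hpq =>
  S.marginalInv_spec.1.monotoneOn (S.clamp_mem p) (S.clamp_mem q)
    (max_le_max le_rfl (min_le_min hpq le_rfl))

theorem supply_eq {p : ℝ} (hp : p ∈ Icc S.cLow S.cHigh) : S.supply p = S.marginalInv p := by
  rw [supply, min_eq_left hp.2, max_eq_right hp.1]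

theorem supply_cLow : S.supply S.cLow = 0 := by
  rw [S.supply_eq (left_mem_Icc.2 S.cLow_lt_cHigh.le)]
  exact S.marginalInv_spec.2.2.2 0 zero_mem

theorem supply_of_cHigh_le {p : ℝ} (hp : S.cHigh ≤ p) : S.supply p = 1 := by
  rw [supply, min_eq_right hp, max_eq_right S.cLow_lt_cHigh.le]
  exact S.marginalInv_spec.2.2.2 1 one_mem

theorem supply_pos {p : ℝ} (hp : S.cLow < p) : 0 < S.supply p := by
  rw [← S.supply_cLow, supply_eq _ (left_mem_Icc.2 S.cLow_lt_cHigh.le)]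
  refine S.marginalInv_spec.1 (left_mem_Icc.2 S.cLow_lt_cHigh.le) (S.clamp_mem p) ?_
  exact lt_max_of_lt_right (lt_min hp S.cLow_lt_cHigh)

theorem marginal_lt_of_lt_supply {p y : ℝ} (h0 : 0 ≤ y) (hy : y < S.supply p) :
    S.marginal y < p := by
  have h := S.strictMonoOn_marginal ⟨h0, hy.le.trans (S.supply_mem p).2⟩ (S.supply_mem p) hy
  rw [supply, (S.marginalInv_spec.2.2.1 _ (S.clamp_mem p)).2] at h
  rcases lt_max_iff.1 h with h | h
  · have := S.strictMonoOn_marginal.monotoneOn zero_mem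
      ⟨h0, hy.le.trans (S.supply_mem p).2⟩ h0
    exact absurd h (not_lt.2 this)
  · exact h.trans_le (min_le_left _ _)

theorem lt_marginal_of_supply_lt {p y : ℝ} (h0 : y ≤ 1) (hy : S.supply p < y) :
    p < S.marginal y := by
  have hy' : y ∈ Icc (0 : ℝ) 1 := ⟨(S.supply_mem p).1.trans hy.le, h0⟩
  have h := S.strictMonoOn_marginal (S.supply_mem p) hy' hy
  rw [supply, (S.marginalInv_spec.2.2.1 _ (S.clamp_mem p)).2] at h
  rcases min_lt_iff.1 ((le_max_right _ _).trans_lt h) with h | h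
  · exact h
  · have := S.strictMonoOn_marginal.monotoneOn hy' one_mem h0
    exact absurd h (not_lt.2 this)

theorem continuousOn_profit (p : ℝ) : ContinuousOn (S.profit p) (Icc 0 1) :=
  (continuousOn_const.mul continuousOn_id).sub S.continuousOn_f

theorem hasDerivAt_profit (p : ℝ) {y : ℝ} (hy : y ∈ Ioo (0 : ℝ) 1) :
    HasDerivAt (S.profit p) (p - S.marginal y) y := by
  have h := ((hasDerivAt_id y).const_mul p).sub (S.hasDerivAt_marginal hy)
  rw [mul_one] at h
  exact h

theorem strictMonoOn_profit (p : ℝ) : StrictMonoOn (S.profit p) (Icc 0 (S.supply p)) := by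
  have hs := S.supply_mem p
  refine strictMonoOn_of_deriv_pos (convex_Icc _ _)
    ((S.continuousOn_profit p).mono (Icc_subset_Icc_right hs.2)) fun y hy => ?_
  rw [interior_Icc] at hy
  rw [(S.hasDerivAt_profit p ⟨hy.1, hy.2.trans_le hs.2⟩).deriv]
  exact sub_pos.2 (S.marginal_lt_of_lt_supply hy.1.le hy.2)

theorem strictAntiOn_profit (p : ℝ) : StrictAntiOn (S.profit p) (Icc (S.supply p) 1) := by
  have hs := S.supply_mem p
  refine strictAntiOn_of_deriv_neg (convex_Icc _ _)
    ((S.continuousOn_profit p).mono (Icc_subset_Icc_left hs.1)) fun y hy => ?_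
  rw [interior_Icc] at hy
  rw [(S.hasDerivAt_profit p ⟨hs.1.trans_lt hy.1, hy.2⟩).deriv]
  exact sub_neg.2 (S.lt_marginal_of_supply_lt hy.2.le hy.1)

theorem profit_lt_conj {p y : ℝ} (hy : y ∈ Icc (0 : ℝ) 1) (hne : y ≠ S.supply p) :
    S.profit p y < S.conj p := by
  have hs := S.supply_mem p
  rcases lt_or_gt_of_ne hne with h | h
  · exact S.strictMonoOn_profit p ⟨hy.1, h.le⟩ (right_mem_Icc.2 hs.1) h
  · exact S.strictAntiOn_profit p (left_mem_Icc.2 hs.2) ⟨h.le, hy.2⟩ h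

theorem profit_le_conj (p : ℝ) {y : ℝ} (hy : y ∈ Icc (0 : ℝ) 1) : S.profit p y ≤ S.conj p := by
  by_cases h : y = S.supply p
  · rw [h]; rfl
  · exact (S.profit_lt_conj hy h).le

theorem profit_zero (p : ℝ) : S.profit p 0 = 0 := by simp [profit, S.f_zero]

theorem profit_sub_profit (p q y : ℝ) : S.profit q y - S.profit p y = (q - p) * y := by
  simp only [profit]; ring

theorem conj_nonneg (p : ℝ) : 0 ≤ S.conj p := by
  rw [← S.profit_zero p]; exact S.profit_le_conj p zero_mem

theorem conj_pos {p : ℝ} (hp : S.cLow < p) : 0 < S.conj p := by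
  rw [← S.profit_zero p]; exact S.profit_lt_conj zero_mem (S.supply_pos hp).ne

theorem conj_cLow : S.conj S.cLow = 0 := by rw [conj, supply_cLow, profit_zero]

/-- The supply is a subgradient of the conjugate: the maximizer at `p` is merely a candidate at `q`.
-/
theorem mul_supply_le_conj_sub (p q : ℝ) : (q - p) * S.supply p ≤ S.conj q - S.conj p := by
  rw [← S.profit_sub_profit p q]
  have := S.profit_le_conj q (S.supply_mem p)
  simp only [conj] at *; linarith

theorem conj_sub_le_mul_supply (p q : ℝ) : S.conj q - S.conj p ≤ (q - p) * S.supply q := by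
  have := S.mul_supply_le_conj_sub q p
  linarith

theorem monotone_conj : Monotone S.conj := fun p q hpq => by
  have := S.mul_supply_le_conj_sub p q
  have := mul_nonneg (sub_nonneg.2 hpq) (S.supply_mem p).1
  linarith

/-- Envelope theorem. The two subgradient inequalities trap the difference quotient between the
supplies at `p` and `q`, so continuity of `supply` suffices and `f'⁻¹` need not be differentiable.
-/
theorem hasDerivAt_conj (p : ℝ) : HasDerivAt S.conj (S.supply p) p := by
  rw [hasDerivAt_iff_tendsto_slope]
  have h1 : Tendsto (fun q => min (S.supply p) (S.supply q)) (𝓝[≠] p) (𝓝 (S.supply p)) := by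
    have : Continuous fun q => min (S.supply p) (S.supply q) :=
      continuous_const.min S.continuous_supply
    simpa using (this.tendsto p).mono_left nhdsWithin_le_nhds
  have h2 : Tendsto (fun q => max (S.supply p) (S.supply q)) (𝓝[≠] p) (𝓝 (S.supply p)) := by
    have : Continuous fun q => max (S.supply p) (S.supply q) :=
      continuous_const.max S.continuous_supply
    simpa using (this.tendsto p).mono_left nhdsWithin_le_nhds
  refine tendsto_of_tendsto_of_tendsto_of_le_of_le' h1 h2 ?_ ?_ <;>
    refine eventually_nhdsWithin_of_forall fun q hq => ?_ <;>
    have ha := S.mul_supply_le_conj_sub p q <;>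
    have hb := S.conj_sub_le_mul_supply p q <;>
    rw [slope_def_field] <;>
    rcases lt_or_gt_of_ne (show q ≠ p from hq) with h | h
  · refine (min_le_right _ _).trans ?_
    rw [le_div_iff_of_neg (sub_neg.2 h)]; linarith
  · refine (min_le_left _ _).trans ?_
    rw [le_div_iff₀ (sub_pos.2 h)]; linarith
  · refine le_trans ?_ (le_max_left _ _)
    rw [div_le_iff_of_neg (sub_neg.2 h)]; linarith
  · refine le_trans ?_ (le_max_right _ _)
    rw [div_le_iff₀ (sub_pos.2 h)]; linarith

theorem continuous_conj : Continuous S.conj :=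
  continuous_iff_continuousAt.2 fun p => (S.hasDerivAt_conj p).continuousAt

/-- Every profit between `0` and the maximum is attained by a utilization below the supply. -/
theorem exists_profit_eq {p r : ℝ} (h0 : 0 ≤ r) (h1 : r ≤ S.conj p) :
    ∃ y ∈ Icc 0 (S.supply p), S.profit p y = r := by
  have hs := S.supply_mem p
  have := intermediate_value_Icc hs.1
    ((S.continuousOn_profit p).mono (Icc_subset_Icc_right hs.2))
  rw [S.profit_zero] at this
  exact this ⟨h0, h1⟩

end Setup

/-! ### The market and the primal-dual analysis of posted prices. -/

namespace Setup

variable {K : Type*} (S : Setup K)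

section Market

variable {S} {ε : ℝ}

theorem demand_nonneg' (hε : 0 < ε) (b : S.Bundle) (k : K) : 0 ≤ S.demand ε b k :=
  mul_nonneg hε.le (S.demand_nonneg b.1 b.2 k)

@[simp] theorem demand_emptyBundle (k : K) : S.demand ε S.emptyBundle k = 0 := by
  simp [demand, emptyBundle]

@[simp] theorem utilization_zero (a : ℕ → S.Bundle) (k : K) : S.utilization ε a 0 k = 0 := by
  simp [utilization]

theorem utilization_succ (a : ℕ → S.Bundle) (n : ℕ) (k : K) :
    S.utilization ε a (n + 1) k = S.utilization ε a n k + S.demand ε (a n) k :=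
  Finset.sum_range_succ _ _

theorem utilization_mono (hε : 0 < ε) (a : ℕ → S.Bundle) (k : K) :
    Monotone fun n => S.utilization ε a n k :=
  monotone_nat_of_le_succ fun n => by
    rw [utilization_succ]
    linarith [demand_nonneg' hε (a n) k]

theorem utilization_congr {a a' : ℕ → S.Bundle} {n : ℕ} (h : ∀ i < n, a i = a' i) :
    S.utilization ε a n = S.utilization ε a' n := by
  ext k
  exact Finset.sum_congr rfl fun i hi => by rw [h i (Finset.mem_range.1 hi)]

theorem le_pbar_mul_demand (hε : 0 < ε) {w : S.Valuation}
    (hw : ∀ (b : S.Bundle) (k : K), S.demand ε b k ≠ 0 → w b / S.demand ε b k ≤ S.pbar)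
    {b : S.Bundle} {k : K} (hk : S.demand ε b k ≠ 0) : w b ≤ S.pbar * S.demand ε b k :=
  (div_le_iff₀ (lt_of_le_of_ne (demand_nonneg' hε b k) hk.symm)).1 (hw b k hk)

variable [Fintype K]

theorem exists_bundle_bound (S : Setup K) : ∃ B > 0, ∀ b ∈ S.bundles, ∀ k, b k ≤ B := by
  have hn : ∀ b ∈ S.bundles, 0 ≤ ∑ k, b k := fun b hb =>
    Finset.sum_nonneg fun k _ => S.demand_nonneg b hb k
  refine ⟨1 + ∑ b ∈ S.bundles, ∑ k, b k, ?_, fun b hb k => ?_⟩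
  · have := Finset.sum_nonneg hn
    linarith
  · have h1 := Finset.single_le_sum hn hb
    have h2 := Finset.single_le_sum (fun k _ => S.demand_nonneg b hb k) (Finset.mem_univ k)
    linarith

/-- Used to charge an error made once per customer to the demand of that customer's offline bundle,
whose total is bounded by capacity. There are finitely many shapes. -/
theorem exists_one_le_mul_sum (S : Setup K) : ∃ D ≥ 0, ∀ b ∈ S.bundles, b ≠ 0 → 1 ≤ D * ∑ k, b k := by
  have hn : ∀ b ∈ S.bundles, 0 ≤ ∑ k, b k := fun b hb =>
    Finset.sum_nonneg fun k _ => S.demand_nonneg b hb k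
  have hn' : ∀ b ∈ S.bundles, 0 ≤ (∑ k, b k)⁻¹ := fun b hb => inv_nonneg.2 (hn b hb)
  refine ⟨∑ b ∈ S.bundles, (∑ k, b k)⁻¹, Finset.sum_nonneg hn', fun b hb hb0 => ?_⟩
  have hpos : 0 < ∑ k, b k := by
    obtain ⟨k, hk⟩ := Function.ne_iff.1 hb0
    exact Finset.sum_pos' (fun k _ => S.demand_nonneg b hb k)
      ⟨k, Finset.mem_univ k, lt_of_le_of_ne (S.demand_nonneg b hb k) (Ne.symm hk)⟩
  calc (1 : ℝ) = (∑ k, b k)⁻¹ * ∑ k, b k := (inv_mul_cancel₀ hpos.ne').symm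
    _ ≤ _ := mul_le_mul_of_nonneg_right (Finset.single_le_sum hn' hb) hpos.le

/-- Needed only for boundedness of the set whose supremum is `optWelfare`. -/
theorem welfare_le_sum_abs {N : ℕ} (v : ℕ → S.Valuation) {a : ℕ → S.Bundle}
    (ha : S.Feasible ε N a) : S.welfare ε N v a ≤ ∑ n ∈ Finset.range N, ∑ b, |v n b| := by
  have h1 : ∑ n ∈ Finset.range N, v n (a n) ≤ ∑ n ∈ Finset.range N, ∑ b, |v n b| :=
    Finset.sum_le_sum fun n _ => (le_abs_self _).trans
      (Finset.single_le_sum (f := fun b => |v n b|) (fun b _ => abs_nonneg _)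
        (Finset.mem_univ (a n)))
  have h2 : 0 ≤ ∑ k, S.f (S.utilization ε a N k) :=
    Finset.sum_nonneg fun k _ => S.f_nonneg (ha k)
  rw [welfare]
  linarith

theorem welfare_le_optWelfare {N : ℕ} (v : ℕ → S.Valuation) {a : ℕ → S.Bundle}
    (ha : S.Feasible ε N a) : S.welfare ε N v a ≤ S.optWelfare ε N v := by
  refine le_csSup ⟨∑ n ∈ Finset.range N, ∑ b, |v n b|, ?_⟩ ⟨a, ha, rfl⟩
  rintro _ ⟨a', ha', rfl⟩
  exact welfare_le_sum_abs v ha'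

theorem optWelfare_le {N : ℕ} {v : ℕ → S.Valuation} {c : ℝ}
    (h : ∀ a : ℕ → S.Bundle, S.Feasible ε N a → S.welfare ε N v a ≤ c) :
    S.optWelfare ε N v ≤ c := by
  refine csSup_le ⟨_, fun _ => S.emptyBundle, fun k => ?_, rfl⟩ ?_
  · simp [utilization]
  · rintro _ ⟨a, ha, rfl⟩
    exact h a ha

theorem exists_PPM (S : Setup K) (φ : ℝ → ℝ) (ε : ℝ) (N : ℕ) (v : ℕ → S.Valuation) :
    ∃ a, S.PPM φ ε N v a := by
  induction N with
  | zero => exact ⟨fun _ => S.emptyBundle, fun n hn => absurd hn (Nat.not_lt_zero n)⟩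
  | succ N ih =>
    obtain ⟨a, ha⟩ := ih
    have : Nonempty S.Bundle := ⟨S.emptyBundle⟩
    obtain ⟨b, hb⟩ := Finite.exists_max
      (S.utility ε (v N) (fun k => φ (S.utilization ε a N k)))
    classical
    let c : S.Bundle := if S.utility ε (v N) (fun k => φ (S.utilization ε a N k)) b < 0 ∨
        ∃ k, 1 < S.utilization ε a N k + S.demand ε b k then S.emptyBundle else b
    have hu : ∀ n ≤ N, S.utilization ε (Function.update a N c) n = S.utilization ε a n :=
      fun n hn => utilization_congr fun i hi => Function.update_of_ne (by omega) _ _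
    refine ⟨Function.update a N c, fun n hn => ?_⟩
    rw [hu n (by omega)]
    rcases Nat.lt_succ_iff_lt_or_eq.1 hn with h | rfl
    · rw [Function.update_of_ne h.ne]
      exact ha n h
    · refine ⟨b, hb, ?_⟩
      rw [Function.update_self]
      by_cases hc : S.utility ε (v n) (fun k => φ (S.utilization ε a n k)) b < 0 ∨
        ∃ k, 1 < S.utilization ε a n k + S.demand ε b k
      · exact Or.inl ⟨hc, if_pos hc⟩
      · exact Or.inr ⟨hc, if_neg hc⟩

theorem utility_le_of_demand_ne_zero (hε : 0 < ε) {w : S.Valuation}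
    (hw : ∀ (b : S.Bundle) (k : K), S.demand ε b k ≠ 0 → w b / S.demand ε b k ≤ S.pbar)
    {p : K → ℝ} (hp : ∀ k, 0 ≤ p k) {b : S.Bundle} {k : K} (hk : S.demand ε b k ≠ 0) :
    S.utility ε w p b ≤ (S.pbar - p k) * S.demand ε b k := by
  have h1 := le_pbar_mul_demand hε hw hk
  have h2 := Finset.single_le_sum (f := fun k => p k * S.demand ε b k)
    (fun k _ => mul_nonneg (hp k) (demand_nonneg' hε b k)) (Finset.mem_univ k)
  rw [utility]
  linarith

/-- One step of the posted-price mechanism: the customer's utility is nonnegative and almost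
maximal, the purchase fits, and every resource in it is priced at most `pbar`. -/
theorem purchase_spec (hε : 0 < ε) {B η : ℝ} (hB0 : 0 < B) (hη : 0 ≤ η)
    (hB : ∀ b ∈ S.bundles, ∀ k, b k ≤ B) {w : S.Valuation}
    (hw0 : w S.emptyBundle = 0)
    (hw : ∀ (b : S.Bundle) (k : K), S.demand ε b k ≠ 0 → w b / S.demand ε b k ≤ S.pbar)
    {p y : K → ℝ} (hp : ∀ k, 0 ≤ p k) (hy : ∀ k, y k ≤ 1)
    (hη' : ∀ k, 1 < y k + ε * B → S.pbar - η ≤ p k) {b a : S.Bundle}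
    (hb : ∀ b', S.utility ε w p b' ≤ S.utility ε w p b)
    (ha : ((S.utility ε w p b < 0 ∨ ∃ k, 1 < y k + S.demand ε b k) ∧ a = S.emptyBundle) ∨
      (¬ (S.utility ε w p b < 0 ∨ ∃ k, 1 < y k + S.demand ε b k) ∧ a = b)) :
    0 ≤ S.utility ε w p a ∧ (∀ b', S.utility ε w p b' ≤ S.utility ε w p a + η * (ε * B)) ∧
      (∀ k, y k + S.demand ε a k ≤ 1) ∧ (∀ k, S.demand ε a k ≠ 0 → p k ≤ S.pbar) := by
  have hemp : S.utility ε w p S.emptyBundle = 0 := by simp [utility, hw0]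
  have hd : ∀ (b : S.Bundle) k, S.demand ε b k ≤ ε * B := fun b k =>
    mul_le_mul_of_nonneg_left (hB b.1 b.2 k) hε.le
  have hεB : 0 ≤ η * (ε * B) := by positivity
  rcases ha with ⟨hrej, rfl⟩ | ⟨hacc, rfl⟩
  · refine ⟨hemp.ge, fun b' => ?_, fun k => by simpa using hy k, fun k hk => by simp at hk⟩
    rw [hemp, zero_add]
    refine (hb b').trans ?_
    rcases hrej with h | ⟨k, hk⟩
    · linarith
    · have hk0 : S.demand ε b k ≠ 0 := fun h => by
        rw [h, add_zero] at hk
        exact absurd (hy k) (not_le.2 hk)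
      have h1 := utility_le_of_demand_ne_zero hε hw hp hk0
      have h2 := hη' k (hk.trans_le (by linarith [hd b k]))
      refine h1.trans ?_
      exact mul_le_mul (by linarith) (hd b k) (demand_nonneg' hε b k) hη
  · push Not at hacc
    refine ⟨hacc.1, fun b' => by linarith [hb b'], hacc.2, fun k hk => ?_⟩
    have h1 := utility_le_of_demand_ne_zero hε hw hp hk
    have h2 : 0 < S.demand ε a k := lt_of_le_of_ne (demand_nonneg' hε a k) hk.symm
    by_contra! h3
    have := mul_neg_of_neg_of_pos (sub_neg.2 h3) h2
    linarith [hacc.1]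

end Market

theorem f_sub_le {y y' : ℝ} (hy : 0 ≤ y) (hyy : y ≤ y') (hy' : y' ≤ 1) :
    S.f y' - S.f y ≤ S.cHigh * (y' - y) := by
  have h := (S.strictMonoOn_profit S.cHigh).monotoneOn
  rw [S.supply_of_cHigh_le le_rfl] at h
  have := h ⟨hy, hyy.trans hy'⟩ ⟨hy.trans hyy, hy'⟩ hyy
  simp only [profit] at this
  linarith

/-- The price function at which the potential is evaluated: prices capped at `pbar`. -/
noncomputable def cappedPrice (φ : ℝ → ℝ) (y : ℝ) : ℝ := min (φ y) S.pbar

/-- The supply cost plus the `1 / α` share of the dual objective at the current prices. -/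
noncomputable def potential (α : ℝ) (φ : ℝ → ℝ) (y : ℝ) : ℝ :=
  S.f y + 1 / α * S.conj (S.cappedPrice φ y)

/-- A bounded increasing function controlling the discretization error of the revenue. -/
noncomputable def slack (φ : ℝ → ℝ) (w y : ℝ) : ℝ :=
  S.cappedPrice φ y - S.cLow + if y ≤ w then 0 else S.pbar + S.cHigh

/-- The purchase is paid at the old price `φ y`, while `hQ` bounds the potential by the new one. The
differences telescope when `r` is replaced by the maximal demand `e`, which is the first part of
`slack`. A purchase that overshoots `w` occurs at most once per resource, since the price then
exceeds `pbar`; the jump in `slack` covers it. -/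
theorem potential_step {α w : ℝ} {φ : ℝ → ℝ}
    (hφ : StrictMonoOn φ (Icc 0 1)) (hw : w ∈ Ioc (0 : ℝ) 1) (hφ0 : φ 0 = S.cLow)
    (hφw : φ w = S.pbar)
    (hQ : ∀ y y', 0 ≤ y → y ≤ y' → y' ≤ w →
      (S.f y' + 1 / α * S.conj (φ y')) - (S.f y + 1 / α * S.conj (φ y)) ≤ (y' - y) * φ y')
    {y r e : ℝ} (hy : 0 ≤ y) (hr : 0 ≤ r) (hre : r ≤ e) (hyr : y + r ≤ 1)
    (hp : r ≠ 0 → φ y ≤ S.pbar) :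
    S.potential α φ (y + r) - S.potential α φ y ≤
      φ y * r + e * (S.slack φ w (y + r) - S.slack φ w y) := by
  rcases hr.eq_or_lt with rfl | hr0
  · simp
  have hwI : w ∈ Icc (0 : ℝ) 1 := ⟨hw.1.le, hw.2⟩
  have hyI : y ∈ Icc (0 : ℝ) 1 := ⟨hy, by linarith⟩
  have hyI' : y + r ∈ Icc (0 : ℝ) 1 := ⟨by linarith, hyr⟩
  have hyw : y ≤ w := by
    have := hp hr0.ne'
    rwa [← hφw, hφ.le_iff_le hyI hwI] at this
  have hφy : S.cLow ≤ φ y := by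
    rw [← hφ0]; exact hφ.monotoneOn zero_mem hyI hy
  have hc := S.cLow_nonneg
  have hcy : S.cappedPrice φ y = φ y := min_eq_left (hp hr0.ne')
  rcases le_or_gt (y + r) w with h | h
  · have hφr : φ (y + r) ≤ S.pbar := by
      rw [← hφw]; exact hφ.monotoneOn hyI' hwI h
    have hcr : S.cappedPrice φ (y + r) = φ (y + r) := min_eq_left hφr
    have h1 := hQ y (y + r) hy (by linarith) h
    have h2 : φ y ≤ φ (y + r) := hφ.monotoneOn hyI hyI' (by linarith)
    have h3 : r * (φ (y + r) - φ y) ≤ e * (φ (y + r) - φ y) :=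
      mul_le_mul_of_nonneg_right hre (by linarith)
    simp only [potential, slack, hcy, hcr, if_pos hyw, if_pos h]
    linarith
  · have hφr : S.pbar ≤ φ (y + r) := by
      rw [← hφw]; exact hφ.monotoneOn hwI hyI' h.le
    have hcr : S.cappedPrice φ (y + r) = S.pbar := min_eq_right hφr
    have h1 := hQ y w hy hyw le_rfl
    have h2 := S.f_sub_le hw.1.le h.le hyr
    have h3 : 0 ≤ S.pbar := hc.trans S.cLow_lt_pbar.le
    have h4 : 0 ≤ S.cHigh := hc.trans S.cLow_lt_cHigh.le
    have h5 : φ y ≤ S.pbar := hp hr0.ne'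
    have h6 : (w - y) * S.pbar ≤ r * S.pbar := mul_le_mul_of_nonneg_right (by linarith) h3
    have h7 : S.cHigh * (y + r - w) ≤ S.cHigh * r := mul_le_mul_of_nonneg_left (by linarith) h4
    have h8 : r * (S.pbar - φ y + (S.pbar + S.cHigh)) ≤ e * (S.pbar - φ y + (S.pbar + S.cHigh)) :=
      mul_le_mul_of_nonneg_right hre (by linarith)
    have h9 : 0 ≤ r * (S.pbar - φ y) := mul_nonneg hr (by linarith)
    have h10 : 0 ≤ φ y * r := mul_nonneg (by linarith) hr
    rw [hφw] at h1
    simp only [potential, slack, hcy, hcr, if_pos hyw, if_neg (not_le.2 h)]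
    linarith

/-- Sufficient condition for competitiveness: the potential grows at most at the rate of the
price until the price reaches `pbar`. -/
theorem isCompetitive_PPM [Fintype K] {α w : ℝ} {φ : ℝ → ℝ} (hα : 1 ≤ α)
    (hφ : StrictMonoOn φ (Icc 0 1)) (hw : w ∈ Ioc (0 : ℝ) 1) (hφ0 : φ 0 = S.cLow)
    (hφw : φ w = S.pbar) (hcont : ContinuousOn φ (Icc 0 w))
    (hQ : ∀ y y', 0 ≤ y → y ≤ y' → y' ≤ w →
      (S.f y' + 1 / α * S.conj (φ y')) - (S.f y + 1 / α * S.conj (φ y)) ≤ (y' - y) * φ y') :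
    S.IsCompetitive α (S.PPM φ) := by
  intro δ hδ
  have hα0 : 0 < α := by linarith
  have hα1 : 1 / α ≤ 1 := by rw [div_le_one hα0]; exact hα
  have hα2 : 0 < 1 / α := by positivity
  have hcl := S.cLow_nonneg
  have hwI : w ∈ Icc (0 : ℝ) 1 := ⟨hw.1.le, hw.2⟩
  have hpb : 0 ≤ S.pbar := hcl.trans S.cLow_lt_pbar.le
  have hch : 0 ≤ S.cHigh := hcl.trans S.cLow_lt_cHigh.le
  have hφn : ∀ y ∈ Icc (0 : ℝ) 1, 0 ≤ φ y := fun y hy => by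
    have := hφ.monotoneOn zero_mem hy hy.1
    linarith
  obtain ⟨B, hB0, hB⟩ := S.exists_bundle_bound
  obtain ⟨D, hD0, hD⟩ := S.exists_one_le_mul_sum
  set c : ℝ := ((Fintype.card K : ℕ) : ℝ) with hc
  have hc0 : 0 ≤ c := Nat.cast_nonneg _
  set E : ℝ := S.pbar - S.cLow + (S.pbar + S.cHigh) with hE
  have hE0 : 0 ≤ E := by linarith [S.cLow_lt_pbar]
  have hslack : ∀ y, S.slack φ w y ≤ E := fun y => by
    have : S.cappedPrice φ y ≤ S.pbar := min_le_right _ _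
    rw [slack]
    split_ifs <;> linarith
  obtain ⟨η, hη0, hη⟩ : ∃ η > 0, η * B * D * c ≤ δ / 2 := by
    have : 0 < B * D * c + 1 := by positivity
    refine ⟨δ / 2 / (B * D * c + 1), by positivity, ?_⟩
    rw [mul_assoc, mul_assoc, div_mul_eq_mul_div, div_le_iff₀ this]
    apply mul_le_mul_of_nonneg_left _ (by positivity)
    linarith
  obtain ⟨ε₁, hε₁0, hε₁⟩ : ∃ ε₁ > 0, ∀ ε, ε < ε₁ → ε * B * E * c ≤ δ / 2 := by
    have : 0 < B * E * c + 1 := by positivity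
    refine ⟨δ / 2 / (B * E * c + 1), by positivity, fun ε h => ?_⟩
    rw [lt_div_iff₀ this] at h
    rcases le_or_gt ε 0 with h0 | h0
    · have : ε * (B * E * c) ≤ 0 := mul_nonpos_of_nonpos_of_nonneg h0 (by positivity)
      linarith
    · linarith
  -- A bundle can fail to fit only next to full capacity. There the price is at least `pbar - η`: by
  -- continuity if `w` is close to `1`, by monotonicity beyond `w`. So a turned-away customer loses
  -- little.
  obtain ⟨ζ, hζ0, hζ⟩ : ∃ ζ > 0, ∀ y ∈ Icc (0 : ℝ) 1, 1 < y + ζ → S.pbar - η ≤ φ y := by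
    have h1 := hcont w (right_mem_Icc.2 hw.1.le)
    obtain ⟨ζ, hζ0, hζ⟩ := Metric.continuousWithinAt_iff.1 h1 η hη0
    refine ⟨ζ, hζ0, fun y hy hy1 => ?_⟩
    rcases le_or_gt y w with h | h
    · have := hζ ⟨hy.1, h⟩ (by
        rw [Real.dist_eq, abs_sub_lt_iff]; constructor <;> linarith [hw.2])
      rw [Real.dist_eq, abs_sub_lt_iff, hφw] at this
      linarith [this.2]
    · have := hφ.monotoneOn hwI hy h.le
      linarith
  refine ⟨min ε₁ (ζ / B), lt_min hε₁0 (by positivity), fun ε hε0 hε N v hv => ?_⟩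
  refine ⟨S.exists_PPM φ ε N v, fun a ha => ?_⟩
  have hεζ : ε * B < ζ := (lt_div_iff₀ hB0).1 (hε.trans_le (min_le_right _ _))
  have hεE := hε₁ ε (hε.trans_le (min_le_left _ _))
  have hdB : ∀ (b : S.Bundle) k, S.demand ε b k ≤ ε * B := fun b k =>
    mul_le_mul_of_nonneg_left (hB b.1 b.2 k) hε0.le
  set y := S.utilization ε a with hy
  have hy0 : ∀ n k, 0 ≤ y n k := fun n k =>
    Finset.sum_nonneg fun i _ => demand_nonneg' hε0 (a i) k
  have hymono : ∀ k, Monotone fun n => y n k := fun k => utilization_mono hε0 a k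
  set u : ℕ → ℝ := fun n => S.utility ε (v n) (fun k => φ (y n k)) (a n) with hu
  have hstep : ∀ n < N, (∀ k, y n k ≤ 1) → 0 ≤ u n ∧
      (∀ b', S.utility ε (v n) (fun k => φ (y n k)) b' ≤ u n + η * (ε * B)) ∧
      (∀ k, y n k + S.demand ε (a n) k ≤ 1) ∧
      (∀ k, S.demand ε (a n) k ≠ 0 → φ (y n k) ≤ S.pbar) := by
    intro n hn hyn
    obtain ⟨b, hb, hab⟩ := ha n hn
    exact purchase_spec hε0 hB0 hη0.le hB (hv n hn).1 (hv n hn).2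
      (fun k => hφn _ ⟨hy0 n k, hyn k⟩) hyn
      (fun k hk => hζ _ ⟨hy0 n k, hyn k⟩ (by linarith)) hb hab
  have hy1 : ∀ n ≤ N, ∀ k, y n k ≤ 1 := by
    intro n
    induction n with
    | zero => intro _ k; simp [hy]
    | succ n ih =>
      intro hn k
      rw [hy, utilization_succ]
      exact (hstep n hn (ih (by omega))).2.2.1 k
  have hyI : ∀ n ≤ N, ∀ k, y n k ∈ Icc (0 : ℝ) 1 := fun n hn k => ⟨hy0 n k, hy1 n hn k⟩
  refine ⟨fun k => hyI N le_rfl k, ?_⟩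
  have hu0 : ∀ n < N, 0 ≤ u n := fun n hn => (hstep n hn (hy1 n hn.le)).1
  -- revenue from each resource
  have hrev : ∀ k, ∀ n ≤ N, S.potential α φ (y n k) - ε * B * S.slack φ w (y n k) ≤
      ∑ i ∈ Finset.range n, φ (y i k) * S.demand ε (a i) k := by
    intro k n
    induction n with
    | zero =>
      intro _
      have h1 : S.cappedPrice φ 0 = S.cLow := by
        rw [cappedPrice, hφ0]; exact min_eq_left S.cLow_lt_pbar.le
      simp [hy, potential, slack, h1, S.f_zero, S.conj_cLow, hw.1.le]
    | succ n ih =>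
      intro hn
      have h1 := hstep n hn (hy1 n (by omega))
      have h2 := S.potential_step hφ hw hφ0 hφw hQ (hy0 n k) (demand_nonneg' hε0 (a n) k)
        (hdB (a n) k) (h1.2.2.1 k) (h1.2.2.2 k)
      rw [Finset.sum_range_succ, hy, utilization_succ]
      have := ih (by omega)
      rw [hy] at this h2
      linarith
  set lam : K → ℝ := fun k => S.cappedPrice φ (y N k) with hlam
  have hlam0 : ∀ k, 0 ≤ lam k := fun k => le_min (hφn _ (hyI N le_rfl k)) hpb
  have honline : ∑ n ∈ Finset.range N, u n + 1 / α * ∑ k, S.conj (lam k) - ε * B * E * c ≤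
      S.welfare ε N v a := by
    have h1 : ∑ n ∈ Finset.range N, v n (a n) = ∑ n ∈ Finset.range N, u n +
        ∑ k, ∑ n ∈ Finset.range N, φ (y n k) * S.demand ε (a n) k := by
      rw [Finset.sum_comm, ← Finset.sum_add_distrib]
      exact Finset.sum_congr rfl fun n _ => by simp [hu, utility]
    have h2 : ∑ k, (S.f (y N k) + 1 / α * S.conj (lam k) - ε * B * E) ≤
        ∑ k, ∑ n ∈ Finset.range N, φ (y n k) * S.demand ε (a n) k := by
      refine Finset.sum_le_sum fun k _ => le_trans ?_ (hrev k N le_rfl)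
      have := mul_le_mul_of_nonneg_left (hslack (y N k)) (by positivity : 0 ≤ ε * B)
      rw [potential]
      linarith
    rw [Finset.sum_sub_distrib, Finset.sum_add_distrib, ← Finset.mul_sum, Finset.sum_const,
      Finset.card_univ, nsmul_eq_mul, ← hc] at h2
    rw [welfare, h1]
    linarith
  -- dual bound on the offline optimum
  have hoff : S.optWelfare ε N v ≤ ∑ n ∈ Finset.range N, u n + ∑ k, S.conj (lam k) +
      η * B * D * c := by
    refine optWelfare_le fun a' ha' => ?_
    have hcust : ∀ n ∈ Finset.range N, v n (a' n) - ∑ k, lam k * S.demand ε (a' n) k ≤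
        u n + ∑ k, η * B * D * S.demand ε (a' n) k := by
      intro n hn
      have hn := Finset.mem_range.1 hn
      have hdn : ∀ k, 0 ≤ S.demand ε (a' n) k := demand_nonneg' hε0 (a' n)
      have hun := hu0 n hn
      have hnn : 0 ≤ ∑ k, η * B * D * S.demand ε (a' n) k :=
        Finset.sum_nonneg fun k _ => mul_nonneg (by positivity) (hdn k)
      by_cases hemp : a' n = S.emptyBundle
      · simp only [hemp, (hv n hn).1, demand_emptyBundle, mul_zero, Finset.sum_const_zero]
        linarith
      -- At the capped prices, a bundle containing a resource priced at `pbar` has no positive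
      -- utility. Otherwise the cap is inactive on the bundle and prices have only risen since the
      -- customer's arrival.
      by_cases hcap : ∃ k, S.demand ε (a' n) k ≠ 0 ∧ S.pbar ≤ φ (y N k)
      · obtain ⟨k, hk, hkp⟩ := hcap
        have h1 := utility_le_of_demand_ne_zero hε0 (hv n hn).2 hlam0 hk
        rw [show lam k = S.pbar from min_eq_right hkp, sub_self, zero_mul, utility] at h1
        linarith
      · push Not at hcap
        have h1 := (hstep n hn (hy1 n hn.le)).2.1 (a' n)
        have h2 : ∑ k, φ (y n k) * S.demand ε (a' n) k ≤ ∑ k, lam k * S.demand ε (a' n) k := by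
          refine Finset.sum_le_sum fun k _ => ?_
          by_cases hk : S.demand ε (a' n) k = 0
          · simp [hk]
          · refine mul_le_mul_of_nonneg_right ?_ (hdn k)
            rw [show lam k = φ (y N k) from min_eq_left (hcap k hk).le]
            exact hφ.monotoneOn (hyI n hn.le k) (hyI N le_rfl k) (hymono k hn.le)
        -- The error per customer is charged to the nonempty offline bundle; summed over customers
        -- it is at most `η * B * D` times the number of resources, independently of `N` and `ε`.
        have h3 : η * (ε * B) ≤ ∑ k, η * B * D * S.demand ε (a' n) k := by
          have h4 := hD (a' n).1 (a' n).2 (fun h => hemp (Subtype.ext h))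
          have h5 : ∑ k, η * B * D * S.demand ε (a' n) k =
              η * (ε * B) * (D * ∑ k, (a' n).1 k) := by
            simp only [demand, Finset.mul_sum]
            exact Finset.sum_congr rfl fun k _ => by ring
          rw [h5]
          exact le_mul_of_one_le_right (by positivity) h4
        rw [utility] at h1
        linarith
    have hsum := Finset.sum_le_sum hcust
    rw [Finset.sum_sub_distrib, Finset.sum_add_distrib, Finset.sum_comm,
      Finset.sum_comm (s := Finset.range N)] at hsum
    simp only [← Finset.mul_sum] at hsum
    have h1 : ∑ k, S.utilization ε a' N k ≤ c := by
      refine (Finset.sum_le_sum fun k _ => (ha' k).2).trans ?_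
      simp [hc]
    have h2 : ∑ k, lam k * S.utilization ε a' N k - ∑ k, S.f (S.utilization ε a' N k) ≤
        ∑ k, S.conj (lam k) := by
      rw [← Finset.sum_sub_distrib]
      exact Finset.sum_le_sum fun k _ => S.profit_le_conj (lam k) (ha' k)
    have h3 := mul_le_mul_of_nonneg_left h1 (by positivity : 0 ≤ η * B * D)
    simp only [utilization] at h1 h2 h3 ⊢
    rw [welfare]
    simp only [utilization]
    linarith
  have hU : 0 ≤ ∑ n ∈ Finset.range N, u n :=
    Finset.sum_nonneg fun n hn => hu0 n (Finset.mem_range.1 hn)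
  have h1 := mul_le_mul_of_nonneg_left hoff hα2.le
  have h2 : 1 / α * ∑ n ∈ Finset.range N, u n ≤ ∑ n ∈ Finset.range N, u n :=
    mul_le_of_le_one_left hU hα1
  have h3 : 1 / α * (η * B * D * c) ≤ η * B * D * c :=
    mul_le_of_le_one_left (by positivity) hα1
  linarith

end Setup

/-! ### Solutions of the boundary value problems give competitive prices. -/

/-- A comparison principle: a function that grows at most linearly in its excess over `c` stays
below `c` once it is there. -/
theorem le_of_deriv_le_mul_sub {φ φ' : ℝ → ℝ} {x e c K : ℝ} (hxe : x ≤ e)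
    (hφ : ContinuousOn φ (Icc x e)) (hφ' : ∀ y ∈ Ico x e, HasDerivAt φ (φ' y) y)
    (hK : 0 < K) (hc : φ x ≤ c) (h : ∀ y ∈ Ico x e, c < φ y → φ' y ≤ K * (φ y - c)) :
    φ e ≤ c := by
  -- An exponential barrier of rate `2 * K` strictly outgrows the allowed rate `K`; afterwards `η`
  -- tends to `0`.
  have key : ∀ η > 0, φ e ≤ c + η * Real.exp (2 * K * (e - x)) := by
    intro η hη
    have hB : ∀ y, HasDerivAt (fun y => c + η * Real.exp (2 * K * (y - x)))
        (2 * K * (η * Real.exp (2 * K * (y - x)))) y := by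
      intro y
      have h1 : HasDerivAt (fun y => 2 * K * (y - x)) (2 * K) y := by
        simpa using ((hasDerivAt_id y).sub_const x).const_mul (2 * K)
      exact ((h1.exp.const_mul η).const_add c).congr_deriv (by ring)
    refine image_le_of_deriv_right_lt_deriv_boundary hφ
      (fun y hy => (hφ' y hy).hasDerivWithinAt) (by simp; linarith) hB (fun y hy hyB => ?_)
      (right_mem_Icc.2 hxe)
    have hpos : 0 < η * Real.exp (2 * K * (y - x)) := by positivity
    have h1 := h y hy (by rw [hyB]; linarith)
    rw [hyB] at h1
    have := mul_pos hK hpos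
    linarith
  refine le_of_forall_pos_le_add fun η hη => ?_
  have := key (η / Real.exp (2 * K * (e - x))) (by positivity)
  rwa [div_mul_cancel₀ _ (Real.exp_pos _).ne'] at this

namespace Setup

variable {K : Type*} (S : Setup K)

/-- By the differential equation the potential has derivative `φ`; monotonicity and the mean value
inequality bound its increment by the final price. -/
theorem potential_sub_le {α l e : ℝ} {φ : ℝ → ℝ} (hα : 0 < α) (hl : 0 ≤ l) (he : e ≤ 1)
    (hmono : MonotoneOn φ (Icc l e)) (hcont : ContinuousOn φ (Icc l e))
    (hpos : ∀ y ∈ Ioo l e, 0 < S.supply (φ y))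
    (hode : ∀ y ∈ Ioo l e, HasDerivAt φ (α * ((φ y - S.marginal y) / S.supply (φ y))) y)
    {y y' : ℝ} (hy : l ≤ y) (hyy : y ≤ y') (hy' : y' ≤ e) :
    (S.f y' + 1 / α * S.conj (φ y')) - (S.f y + 1 / α * S.conj (φ y)) ≤ (y' - y) * φ y' := by
  have hsub : Icc y y' ⊆ Icc l e := Icc_subset_Icc hy hy'
  have hsub' : Ioo y y' ⊆ Ioo l e := Ioo_subset_Ioo hy hy'
  have hd : ∀ x ∈ Ioo y y', HasDerivAt (fun x => S.f x + 1 / α * S.conj (φ x)) (φ x) x := by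
    intro x hx
    have hx' := hsub' hx
    have h1 := S.hasDerivAt_marginal ⟨hl.trans_lt hx'.1, hx'.2.trans_le he⟩
    have h2 := ((S.hasDerivAt_conj (φ x)).comp x (hode x hx')).const_mul (1 / α)
    refine (h1.add h2).congr_deriv ?_
    have := (hpos x hx').ne'
    field_simp
    ring
  have hc : ContinuousOn (fun x => S.f x + 1 / α * S.conj (φ x)) (Icc y y') :=
    ((S.continuousOn_f.mono (hsub.trans (Icc_subset_Icc hl he))).add
      (continuousOn_const.mul (S.continuous_conj.comp_continuousOn (hcont.mono hsub))))
  have := (convex_Icc y y').image_sub_le_mul_sub_of_deriv_le hc (C := φ y')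
    (fun x hx => by
      rw [interior_Icc] at hx
      exact (hd x hx).differentiableAt.differentiableWithinAt)
    (fun x hx => by
      rw [interior_Icc] at hx
      rw [(hd x hx).deriv]
      exact hmono (hsub (Ioo_subset_Icc_self hx)) (hsub (right_mem_Icc.2 hyy)) hx.2.le)
    y (left_mem_Icc.2 hyy) y' (right_mem_Icc.2 hyy) hyy
  linarith

theorem SolvesL.isCompetitive [Fintype K] {S : Setup K} {α : ℝ} {φ : ℝ → ℝ} (hα : 1 ≤ α)
    (hlow : S.pbar ≤ S.cHigh) (hφ : StrictMonoOn φ (Icc 0 1)) (h : S.SolvesL α φ) :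
    S.IsCompetitive α (S.PPM φ) := by
  have hp : S.pbar ∈ Icc S.cLow S.cHigh := ⟨S.cLow_lt_pbar.le, hlow⟩
  have hv := S.supply_mem S.pbar
  rw [S.supply_eq hp] at hv
  obtain ⟨w, hw, hφw⟩ : S.pbar ∈ φ '' Icc 0 (S.marginalInv S.pbar) :=
    intermediate_value_Icc hv.1 h.cont ⟨by rw [h.left]; exact hp.1, h.right⟩
  have hw0 : 0 < w := by
    refine lt_of_le_of_ne hw.1 fun h0 => ?_
    rw [← h0, h.left] at hφw
    exact S.cLow_lt_pbar.ne hφw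
  have hw1 : w ≤ 1 := hw.2.trans hv.2
  have hsub : Icc 0 w ⊆ Icc 0 (S.marginalInv S.pbar) := Icc_subset_Icc_right hw.2
  have hrange : ∀ y ∈ Ioo 0 w, S.cLow < φ y ∧ φ y ≤ S.cHigh := fun y hy =>
    ⟨h.low y ⟨hy.1, hy.2.trans_le hw.2⟩, by
      rw [← hφw] at hlow
      exact (hφ ⟨hy.1.le, hy.2.le.trans hw1⟩ ⟨hw.1, hw1⟩ hy.2).le.trans hlow⟩
  refine S.isCompetitive_PPM hα hφ ⟨hw0, hw1⟩ h.left hφw (h.cont.mono hsub)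
    fun y y' h0 hyy hy' => ?_
  refine S.potential_sub_le (by linarith) le_rfl hw1
    (hφ.monotoneOn.mono (Icc_subset_Icc_right hw1)) (h.cont.mono hsub)
    (fun y hy => S.supply_pos (hrange y hy).1) (fun y hy => ?_) h0 hyy hy'
  rw [S.supply_eq ⟨(hrange y hy).1.le, (hrange y hy).2⟩]
  exact h.ode y ⟨hy.1, hy.2.trans_le hw.2⟩ (hrange y hy).2

/-- A solution that ends above the marginal cost stays above the marginal cost and increases. -/
theorem strictMonoOn_of_ode {α l e : ℝ} {φ : ℝ → ℝ} (hα : 0 < α) (hl : 0 ≤ l) (he : e ≤ 1)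
    (hcont : ContinuousOn φ (Icc l e)) (hpos : ∀ y ∈ Ioo l e, 0 < S.supply (φ y))
    (hode : ∀ y ∈ Ioo l e, HasDerivAt φ (α * ((φ y - S.marginal y) / S.supply (φ y))) y)
    (hend : ∀ y ∈ Ioo l e, S.marginal y < φ e) : StrictMonoOn φ (Icc l e) := by
  have hab : ∀ y ∈ Ioo l e, S.marginal y < φ y := by
    intro y hy
    by_contra! hle
    refine absurd (hend y hy) (not_lt.2 (le_trans ?_ hle))
    -- If `φ` were at or below the marginal cost at `y`, it could never exceed `φ y` again,
    -- contradicting `hend`. Above that level the supply is at least `supply (φ y)`, whence the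
    -- constant.
    refine le_of_deriv_le_mul_sub (K := α / S.supply (φ y)) hy.2.le
      (hcont.mono (Icc_subset_Icc_left hy.1.le))
      (fun x hx => hode x ⟨hy.1.trans_le hx.1, hx.2⟩) (div_pos hα (hpos y hy)) le_rfl
      fun x hx hlt => ?_
    have hx' : x ∈ Ioo l e := ⟨hy.1.trans_le hx.1, hx.2⟩
    have h1 : S.marginal y ≤ S.marginal x := S.strictMonoOn_marginal.monotoneOn
      ⟨hl.trans hy.1.le, hy.2.le.trans he⟩ ⟨hl.trans hx'.1.le, hx.2.le.trans he⟩ hx.1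
    have h2 := S.monotone_supply hlt.le
    rw [← mul_div_assoc, div_mul_eq_mul_div]
    calc α * (φ x - S.marginal x) / S.supply (φ x) ≤ α * (φ x - φ y) / S.supply (φ x) := by
          have := hpos x hx'
          gcongr
          linarith
      _ ≤ α * (φ x - φ y) / S.supply (φ y) :=
          div_le_div_of_nonneg_left (mul_nonneg hα.le (by linarith)) (hpos y hy) h2
  refine strictMonoOn_of_deriv_pos (convex_Icc _ _) hcont fun y hy => ?_
  rw [interior_Icc] at hy
  rw [(hode y hy).deriv]
  exact mul_pos hα (div_pos (sub_pos.2 (hab y hy)) (hpos y hy))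

theorem SolvesH1.isCompetitive [Fintype K] {S : Setup K} {α u : ℝ} {φ : ℝ → ℝ} (hα : 1 ≤ α)
    (hhigh : S.cHigh < S.pbar) (hu : u ∈ Ioo (0 : ℝ) 1) (h1 : S.SolvesH1 u α φ)
    (h2 : S.SolvesH2 u α φ) : S.IsCompetitive α (S.PPM φ) := by
  have hα0 : 0 < α := by linarith
  have hpos1 : ∀ y ∈ Ioo 0 u, 0 < S.supply (φ y) := fun y hy => S.supply_pos (h1.range y hy).1
  have hode1 : ∀ y ∈ Ioo 0 u,
      HasDerivAt φ (α * ((φ y - S.marginal y) / S.supply (φ y))) y := fun y hy => by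
    rw [S.supply_eq ⟨(h1.range y hy).1.le, (h1.range y hy).2⟩]
    exact h1.ode y hy
  have hmono1 : StrictMonoOn φ (Icc 0 u) :=
    S.strictMonoOn_of_ode hα0 le_rfl hu.2.le h1.cont hpos1 hode1 fun y hy => by
      rw [h1.right]
      exact S.strictMonoOn_marginal ⟨hy.1.le, (hy.2.trans hu.2).le⟩ one_mem (hy.2.trans hu.2)
  have hmarg : ∀ y ∈ Ioo u 1, S.marginal y < S.cHigh := fun y hy =>
    S.strictMonoOn_marginal ⟨(hu.1.trans hy.1).le, hy.2.le⟩ one_mem hy.2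
  have hge : ∀ y ∈ Icc u 1, S.cHigh ≤ φ y := by
    -- `SolvesH2` does not assert `φ ≥ cHigh` on `(u, 1)`, which is needed to identify `supply (φ
    -- y)` with `1`. The end value at `1` yields it by comparison.
    have key : ∀ y ∈ Ioo u 1, S.marginal y < φ y := by
      intro y hy
      by_contra! hle
      have : φ 1 ≤ φ y := by
        refine le_of_deriv_le_mul_sub hy.2.le (h2.cont.mono (Icc_subset_Icc_left hy.1.le))
          (fun x hx => h2.ode x ⟨hy.1.trans_le hx.1, hx.2⟩) hα0 le_rfl fun x hx hlt => ?_
        have : S.marginal y ≤ S.marginal x := S.strictMonoOn_marginal.monotoneOn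
          ⟨(hu.1.trans hy.1).le, hy.2.le⟩
          ⟨(hu.1.trans (hy.1.trans_le hx.1)).le, hx.2.le⟩ hx.1
        exact mul_le_mul_of_nonneg_left (by linarith) hα0.le
      linarith [h2.right, hmarg y hy]
    have hm : MonotoneOn φ (Icc u 1) := by
      refine monotoneOn_of_deriv_nonneg (convex_Icc _ _) h2.cont (fun y hy => ?_) fun y hy => ?_
      · rw [interior_Icc] at hy
        exact (h2.ode y hy).differentiableAt.differentiableWithinAt
      · rw [interior_Icc] at hy
        rw [(h2.ode y hy).deriv]
        exact mul_nonneg hα0.le (sub_nonneg.2 (key y hy).le)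
    intro y hy
    rw [← h2.left]
    exact hm (left_mem_Icc.2 hu.2.le) hy hy.1
  have hsup : ∀ y ∈ Icc u 1, S.supply (φ y) = 1 := fun y hy => S.supply_of_cHigh_le (hge y hy)
  have hpos2 : ∀ y ∈ Ioo u 1, 0 < S.supply (φ y) := fun y hy => by
    rw [hsup y (Ioo_subset_Icc_self hy)]; exact one_pos
  have hode2 : ∀ y ∈ Ioo u 1,
      HasDerivAt φ (α * ((φ y - S.marginal y) / S.supply (φ y))) y := fun y hy => by
    rw [hsup y (Ioo_subset_Icc_self hy), div_one]
    exact h2.ode y hy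
  have hmono2 : StrictMonoOn φ (Icc u 1) :=
    S.strictMonoOn_of_ode hα0 hu.1.le le_rfl h2.cont hpos2 hode2 fun y hy =>
      (hmarg y hy).trans (hhigh.trans_le h2.right)
  have hmono : StrictMonoOn φ (Icc 0 1) := by
    have := hmono1.union hmono2 (isGreatest_Icc hu.1.le) (isLeast_Icc hu.2.le)
    rwa [Icc_union_Icc_eq_Icc hu.1.le hu.2.le] at this
  have hcont : ContinuousOn φ (Icc 0 1) := by
    have := h1.cont.union_of_isClosed h2.cont isClosed_Icc isClosed_Icc
    rwa [Icc_union_Icc_eq_Icc hu.1.le hu.2.le] at this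
  obtain ⟨w, hw, hφw⟩ : S.pbar ∈ φ '' Icc u 1 :=
    intermediate_value_Icc hu.2.le h2.cont ⟨by rw [h2.left]; exact hhigh.le, h2.right⟩
  refine S.isCompetitive_PPM hα hmono ⟨hu.1.trans_le hw.1, hw.2⟩ h1.left hφw
    (hcont.mono (Icc_subset_Icc_right hw.2)) fun y y' h0 hyy hy' => ?_
  have hy'1 := hy'.trans hw.2
  have p1 : ∀ {y y' : ℝ}, 0 ≤ y → y ≤ y' → y' ≤ u → _ := fun a b c =>
    S.potential_sub_le hα0 le_rfl hu.2.le hmono1.monotoneOn h1.cont hpos1 hode1 a b c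
  have p2 : ∀ {y y' : ℝ}, u ≤ y → y ≤ y' → y' ≤ 1 → _ := fun a b c =>
    S.potential_sub_le hα0 hu.1.le le_rfl hmono2.monotoneOn h2.cont hpos2 hode2 a b c
  rcases le_total y' u with hyu | hyu
  · exact p1 h0 hyy hyu
  rcases le_total u y with hyu' | hyu'
  · exact p2 hyu' hyy hy'1
  -- Differentiability at `u` is not assumed, so the increments on both sides are added.
  have e1 := p1 h0 hyu' le_rfl
  have e2 := p2 le_rfl hyu hy'1
  have e3 : φ u ≤ φ y' := hmono2.monotoneOn (left_mem_Icc.2 hu.2.le) ⟨hyu, hy'1⟩ hyu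
  have e4 := mul_le_mul_of_nonneg_left e3 (sub_nonneg.2 hyu')
  linarith

end Setup

/-! ### The adversarial instances. -/

namespace Setup

variable {K : Type*} {S : Setup K} {ε : ℝ}

/-- Selling only a single-resource bundle to customers of unit value `p` secures the maximal
profit at price `p` up to the granularity of the demands. -/
theorem conj_sub_le_optWelfare [Fintype K] (hε : 0 < ε) {bb : S.Bundle} {k : K}
    (hk : 0 < bb.1 k) (hj : ∀ j, j ≠ k → bb.1 j = 0) {v : ℕ → S.Valuation} {M G : ℕ} {p : ℝ}
    (hp : 0 ≤ p) (hG : 1 ≤ G * (ε * bb.1 k)) (hv0 : ∀ n < M + G, v n S.emptyBundle = 0)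
    (hv : ∀ n, M ≤ n → n < M + G → v n bb = p * (ε * bb.1 k)) :
    S.conj p - p * (ε * bb.1 k) ≤ S.optWelfare ε (M + G) v := by
  set d := ε * bb.1 k with hd
  have hd0 : 0 < d := mul_pos hε hk
  have hs := S.supply_mem p
  set c := ⌊S.supply p / d⌋₊ with hc
  have hc1 : c * d ≤ S.supply p :=
    (le_div_iff₀ hd0).1 (Nat.floor_le (div_nonneg hs.1 hd0.le))
  have hc2 : S.supply p ≤ c * d + d := by
    have := (div_lt_iff₀ hd0).1 (Nat.lt_floor_add_one (S.supply p / d))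
    rw [← hc] at this
    linarith
  have hcG : c ≤ G := by
    have : (c : ℝ) * d ≤ G * d := (hc1.trans hs.2).trans hG
    exact_mod_cast le_of_mul_le_mul_right this hd0
  classical
  let a : ℕ → S.Bundle := fun n => if n ∈ Finset.Ico M (M + c) then bb else S.emptyBundle
  have hinter : Finset.range (M + G) ∩ Finset.Ico M (M + c) = Finset.Ico M (M + c) := by
    ext n
    simp only [Finset.mem_inter, Finset.mem_range, Finset.mem_Ico]
    omega
  have hsum : ∀ F : ℕ → S.Bundle → ℝ, (∀ n < M + G, F n S.emptyBundle = 0) →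
      ∑ n ∈ Finset.range (M + G), F n (a n) = ∑ n ∈ Finset.Ico M (M + c), F n bb := by
    intro F hF
    rw [← hinter, ← Finset.sum_ite_mem]
    refine Finset.sum_congr rfl fun n hn => ?_
    by_cases h : n ∈ Finset.Ico M (M + c)
    · simp only [a, if_pos h]
    · simp only [a, if_neg h, hF n (Finset.mem_range.1 hn)]
  have hutil : ∀ j, S.utilization ε a (M + G) j = c * (ε * bb.1 j) := by
    intro j
    rw [utilization, hsum (fun _ b => S.demand ε b j) fun _ _ => demand_emptyBundle j]
    simp [demand]
  have hutil0 : ∀ j, j ≠ k → S.utilization ε a (M + G) j = 0 := fun j h => by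
    rw [hutil, hj j h]; ring
  have hval : ∑ n ∈ Finset.range (M + G), v n (a n) = p * (c * d) := by
    rw [hsum (fun n b => v n b) hv0, Finset.sum_congr rfl fun n hn => hv n
      (Finset.mem_Ico.1 hn).1 ((Finset.mem_Ico.1 hn).2.trans_le (by omega))]
    simp
    ring
  have hcd : c * d ∈ Icc (0 : ℝ) 1 := ⟨by positivity, hc1.trans hs.2⟩
  have hfeas : S.Feasible ε (M + G) a := by
    intro j
    by_cases h : j = k
    · rw [h, hutil]; exact hcd
    · rw [hutil0 j h]; exact zero_mem
  refine le_trans ?_ (welfare_le_optWelfare v hfeas)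
  have hcost : ∑ j, S.f (S.utilization ε a (M + G) j) = S.f (c * d) := by
    rw [Finset.sum_eq_single k (fun j _ h => by rw [hutil0 j h, S.f_zero])
      (fun h => absurd (Finset.mem_univ k) h), hutil]
  rw [welfare, hval, hcost, conj, profit]
  have h1 := S.f_mono hcd hs hc1
  have h2 := mul_le_mul_of_nonneg_left hc2 hp
  linarith

/-- Against a competitive algorithm, send groups of many customers with equidistant increasing
unit values for a single-resource bundle. The total amounts `s i` of this bundle sold to the first
`i + 1` groups satisfy a discrete integral inequality. -/
theorem exists_sales_of_isCompetitive [Fintype K] {α : ℝ} (hα : 1 ≤ α)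
    (hS : S.HasSingleResourceBundle) {A : S.OnlineAlgorithm} (hA : S.IsCompetitive α A.run)
    {m : ℕ} {p : ℕ → ℝ} {h : ℝ} (hstep : ∀ i, p (i + 1) = p i + h)
    (hp0 : ∀ i ≤ m, 0 ≤ p i) (hp : ∀ i ≤ m, p i ≤ S.pbar) {δ : ℝ} (hδ : 0 < δ) :
    ∃ s : ℕ → ℝ, ∀ i ≤ m, s i ∈ Icc (0 : ℝ) 1 ∧
      1 / α * S.conj (p i) + h * ∑ j ∈ Finset.range i, s j - δ ≤ S.profit (p i) (s i) := by
  obtain ⟨b, hb, k, hk, hj⟩ := hS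
  let bb : S.Bundle := ⟨b, hb⟩
  have hα0 : 0 < α := by linarith
  have hpb : 0 ≤ S.pbar := S.cLow_nonneg.trans S.cLow_lt_pbar.le
  obtain ⟨ε₀, hε₀, hcomp⟩ := hA (δ / 2) (by positivity)
  obtain ⟨ε, hε, hεε₀, hεδ⟩ : ∃ ε > 0, ε < ε₀ ∧ S.pbar * (ε * b k) ≤ δ / 2 := by
    have hD : 0 < 2 * (S.pbar * b k + 1) := by positivity
    refine ⟨min (ε₀ / 2) (δ / (2 * (S.pbar * b k + 1))), by positivity,
      (min_le_left _ _).trans_lt (by linarith), ?_⟩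
    have h1 := min_le_right (ε₀ / 2) (δ / (2 * (S.pbar * b k + 1)))
    have h2 : 0 < min (ε₀ / 2) (δ / (2 * (S.pbar * b k + 1))) := by positivity
    rw [le_div_iff₀ hD] at h1
    linarith
  set d := ε * b k with hd
  have hd0 : 0 < d := mul_pos hε hk
  -- Each group alone can fill the capacity, so the optimum can serve just the last, most valuable
  -- one.
  set G := ⌈1 / d⌉₊ with hG
  have hG1 : 1 ≤ G * d := (div_le_iff₀ hd0).1 (Nat.le_ceil _)
  have hG0 : 0 < G := Nat.ceil_pos.2 (by positivity)
  classical
  let v : ℕ → S.Valuation := fun n b' => if b' = bb then p (n / G) * d else 0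
  have hbb : S.emptyBundle ≠ bb := fun h => by
    have := congrFun (congrArg Subtype.val h) k
    exact hk.ne this
  have hv0 : ∀ n, v n S.emptyBundle = 0 := fun n => if_neg hbb
  have hvbb : ∀ n, v n bb = p (n / G) * d := fun n => if_pos rfl
  have hinst : ∀ i ≤ m, S.IsInstance ε (G * i + G) v := by
    intro i hi n hn
    refine ⟨hv0 n, fun b' j hj' => ?_⟩
    by_cases hb' : b' = bb
    · have hjk : j = k := by
        by_contra hjk
        exact hj' (by rw [hb', demand]; exact mul_eq_zero_of_right _ (hj j hjk))
      have hnm : n / G ≤ m := by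
        have : n / G < i + 1 := Nat.div_lt_of_lt_mul (by linarith)
        omega
      rw [hb', hjk, hvbb, show S.demand ε bb k = d from rfl, mul_div_cancel_right₀ _ hd0.ne']
      exact hp _ hnm
    · rw [show v n b' = 0 from if_neg hb', zero_div]
      exact hpb
  -- One run serves all stopping times, as online decisions ignore later arrivals.
  let a : ℕ → S.Bundle := fun n => A ε n (fun i => v i)
  have hrun : ∀ N, A.run ε N v a := fun N n _ => rfl
  let cnt : ℕ → ℝ := fun N => ∑ n ∈ Finset.range N, if a n = bb then d else 0
  have hcnt0 : ∀ N, 0 ≤ cnt N := fun N =>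
    Finset.sum_nonneg fun n _ => by split_ifs <;> [exact hd0.le; exact le_rfl]
  have hcntle : ∀ N, cnt N ≤ S.utilization ε a N k := fun N =>
    Finset.sum_le_sum fun n _ => by
      split_ifs with h
      · rw [h]; rfl
      · exact demand_nonneg' hε _ _
  have hgroup : ∀ i, ∑ n ∈ Finset.range (G * i + G), v n (a n) =
      ∑ n ∈ Finset.range (G * i), v n (a n) + p i * (cnt (G * i + G) - cnt (G * i)) := by
    intro i
    simp only [cnt]
    rw [Finset.sum_range_add, Finset.sum_range_add, add_sub_cancel_left, Finset.mul_sum]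
    congr 1
    refine Finset.sum_congr rfl fun x hx => ?_
    have : (G * i + x) / G = i := by
      rw [Nat.mul_add_div hG0, Nat.div_eq_of_lt (Finset.mem_range.1 hx), add_zero]
    simp only [v, this]
    split_ifs <;> simp
  have habel : ∀ i, ∑ n ∈ Finset.range (G * i + G), v n (a n) =
      p i * cnt (G * i + G) - h * ∑ j ∈ Finset.range i, cnt (G * j + G) := by
    intro i
    induction i with
    | zero => rw [hgroup]; simp [cnt]
    | succ i ih =>
      rw [hgroup, Finset.sum_range_succ, hstep]
      rw [show G * (i + 1) = G * i + G by ring] at *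
      rw [ih]
      ring
  refine ⟨fun i => cnt (G * i + G), fun i hi => ?_⟩
  obtain ⟨-, hout⟩ := hcomp ε hε hεε₀ (G * i + G) v (hinst i hi)
  obtain ⟨hfeas, hwel⟩ := hout a (hrun _)
  have hs : cnt (G * i + G) ∈ Icc (0 : ℝ) 1 := ⟨hcnt0 _, (hcntle _).trans (hfeas k).2⟩
  refine ⟨hs, ?_⟩
  have hopt : S.conj (p i) - p i * d ≤ S.optWelfare ε (G * i + G) v :=
    conj_sub_le_optWelfare hε (bb := bb) hk hj (hp0 i hi) hG1 (fun n _ => hv0 n)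
      fun n h1 h2 => by
        rw [hvbb, show n / G = i from
          Nat.div_eq_of_lt_le (by linarith) (by linarith)]
  -- Bundles other than `bb` are worth nothing here and can only add to the cost.
  have hcost : S.f (cnt (G * i + G)) ≤ ∑ j, S.f (S.utilization ε a (G * i + G) j) :=
    (S.f_mono hs (hfeas k) (hcntle _)).trans
      (Finset.single_le_sum (f := fun j => S.f (S.utilization ε a (G * i + G) j))
        (fun j _ => S.f_nonneg (hfeas j)) (Finset.mem_univ k))
  rw [welfare, habel] at hwel
  have h1 : 1 / α * (S.conj (p i) - p i * d) ≤ 1 / α * S.optWelfare ε (G * i + G) v :=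
    mul_le_mul_of_nonneg_left hopt (by positivity)
  have h2 : 1 / α * (p i * d) ≤ p i * d :=
    mul_le_of_le_one_left (mul_nonneg (hp0 i hi) hd0.le) (by rw [div_le_one hα0]; exact hα)
  have h3 : p i * d ≤ S.pbar * d := mul_le_mul_of_nonneg_right (hp i hi) hd0.le
  rw [profit]
  linarith

end Setup

/-! ### Backward solution of the discretized integral equation. -/

namespace Setup

variable {K : Type*} (S : Setup K)

open Classical in
/-- A utilization below the supply at price `p` with profit `r`, if there is one. -/
noncomputable def profitInv (p r : ℝ) : ℝ :=
  if h : ∃ y ∈ Icc 0 (S.supply p), S.profit p y = r then h.choose else 0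

theorem profitInv_spec {p r : ℝ} (h0 : 0 ≤ r) (h1 : r ≤ S.conj p) :
    S.profitInv p r ∈ Icc 0 (S.supply p) ∧ S.profit p (S.profitInv p r) = r := by
  have h := S.exists_profit_eq h0 h1
  rw [profitInv, dif_pos h]
  exact h.choose_spec

/-- Backward Euler steps from the price `q 0` downwards: the current utilization and the
accumulated sum. -/
noncomputable def backwardEuler (α h : ℝ) (q : ℕ → ℝ) : ℕ → ℝ × ℝ
  | 0 => (S.supply (q 0), 0)
  | k + 1 =>
    let x := S.profitInv (q k) (max 0 ((1 - 1 / α) * S.conj (q 0) + 1 / α * S.conj (q (k + 1)) -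
      (backwardEuler α h q k).2))
    (x, (backwardEuler α h q k).2 + h * x)

/-- The implicit equation at price `q (k + 1)` contains the extra term `h * x`; since `profit (q k)
x = profit (q (k + 1)) x + h * x`, it becomes an explicit one at price `q k`. It is solvable unless
its right side `ρ k` is negative, and comparison with the sales `σ` bounds how negative that can
get. -/
theorem exists_backward_scheme {α h δ : ℝ} (hα : 0 < α) (hh : 0 ≤ h) (hδ : 0 ≤ δ) {m : ℕ}
    {q σ Y : ℕ → ℝ} (hq : ∀ k, q k = q (k + 1) + h)
    (hY : ∀ k < m, Y k = Y (k + 1) + h * σ (k + 1)) (hY0 : ∀ k ≤ m, 0 ≤ Y k)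
    (hσ : ∀ k ≤ m, σ k ∈ Icc (0 : ℝ) 1)
    (hineq : ∀ k ≤ m, 1 / α * S.conj (q k) + Y k - δ ≤ S.profit (q k) (σ k)) :
    ∃ χ : ℕ → ℝ, χ 0 = S.supply (q 0) ∧ (∀ k < m, χ (k + 1) ≤ χ k) ∧
      (∀ k ≤ m, χ k ∈ Icc (0 : ℝ) 1) ∧ (∀ k < m, χ (k + 1) ≤ S.supply (q k)) ∧
      ∀ k ≤ m, |S.profit (q k) (χ k) - 1 / α * S.conj (q k) -
        ((1 - 1 / α) * S.conj (q 0) - h * ∑ l ∈ Finset.range k, χ (l + 1))| ≤ h + δ := by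
  set C := (1 - 1 / α) * S.conj (q 0) with hC
  set χ : ℕ → ℝ := fun k => (S.backwardEuler α h q k).1 with hχ
  set X : ℕ → ℝ := fun k => (S.backwardEuler α h q k).2 with hX
  set ρ : ℕ → ℝ := fun k => C + 1 / α * S.conj (q (k + 1)) - X k with hρ
  have hχ0 : χ 0 = S.supply (q 0) := rfl
  have hX0 : X 0 = 0 := rfl
  have hχs : ∀ k, χ (k + 1) = S.profitInv (q k) (max 0 (ρ k)) := fun k => rfl
  have hXs : ∀ k, X (k + 1) = X k + h * χ (k + 1) := fun k => rfl
  have hα' : 0 < 1 / α := by positivity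
  have hconj : ∀ k, 1 / α * S.conj (q (k + 1)) ≤ 1 / α * S.conj (q k) := fun k =>
    mul_le_mul_of_nonneg_left (S.monotone_conj (by linarith [hq k])) hα'.le
  have hshift : ∀ k y, S.profit (q k) y = S.profit (q (k + 1)) y + h * y := fun k y => by
    rw [hq k, profit, profit]; ring
  have hspec : ∀ k, ρ k ≤ S.conj (q k) → χ (k + 1) ∈ Icc 0 (S.supply (q k)) ∧
      S.profit (q k) (χ (k + 1)) = max 0 (ρ k) := fun k hk =>
    S.profitInv_spec (le_max_left _ _) (max_le (S.conj_nonneg _) hk)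
  have hzero : ∀ k, ρ k ≤ S.conj (q k) → ρ k ≤ 0 → χ (k + 1) = 0 := fun k hk h0 => by
    obtain ⟨h1, h2⟩ := hspec k hk
    rw [max_eq_left h0, ← S.profit_zero (q k)] at h2
    exact (S.strictMonoOn_profit (q k)).injOn h1 (left_mem_Icc.2 (S.supply_mem _).1) h2
  have hρs : ∀ k, ρ (k + 1) ≤ ρ k - h * χ (k + 1) := fun k => by
    have := hconj (k + 1)
    simp only [hρ, hXs]
    linarith
  have I1 : ∀ k, ρ k ≤ S.conj (q k) := by
    intro k
    induction k with
    | zero =>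
      have := hconj 0
      simp only [hρ, hX0, hC]
      linarith
    | succ k ih =>
      obtain ⟨h1, h2⟩ := hspec k ih
      rcases le_or_gt 0 (ρ k) with h0 | h0
      · rw [max_eq_right h0, hshift] at h2
        have h3 := S.profit_le_conj (q (k + 1)) ⟨h1.1, h1.2.trans (S.supply_mem _).2⟩
        linarith [hρs k]
      · have h3 := mul_nonneg hh h1.1
        linarith [hρs k, S.conj_nonneg (q (k + 1))]
  have hmem : ∀ k, χ (k + 1) ∈ Icc 0 (S.supply (q k)) := fun k => (hspec k (I1 k)).1
  have hprof : ∀ k, S.profit (q k) (χ (k + 1)) = max 0 (ρ k) := fun k => (hspec k (I1 k)).2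
  have hχI : ∀ k, χ k ∈ Icc (0 : ℝ) 1 := by
    rintro (_ | k)
    · exact S.supply_mem _
    · exact ⟨(hmem k).1, (hmem k).2.trans (S.supply_mem _).2⟩
  -- Here `X k` sums the scheme above the current price and `Y k` the sales below it. If `χ ≤ σ`,
  -- the bound is inherited; if `χ > σ`, it is re-established from `hineq` alone, so errors do not
  -- add up over the steps.
  have I2 : ∀ k ≤ m, -(h + δ) ≤ C - X k - Y k := by
    intro k
    induction k with
    | zero =>
      intro _
      have h1 := hineq 0 (Nat.zero_le _)
      have h2 := S.profit_le_conj (q 0) (hσ 0 (Nat.zero_le _))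
      rw [hX0, hC]
      linarith
    | succ k ih =>
      intro hk
      have h0 := ih (by omega)
      have h1 := hY k hk
      rw [hXs]
      rcases le_or_gt (χ (k + 1)) (σ (k + 1)) with h2 | h2
      · have := mul_le_mul_of_nonneg_left h2 hh
        linarith
      · have hs := hσ (k + 1) hk
        have hρ0 : 0 < ρ k := by
          by_contra! hle
          have := hzero k (I1 k) hle
          linarith [hs.1]
        have h3 := (S.strictMonoOn_profit (q k)) ⟨hs.1, h2.le.trans (hmem k).2⟩ (hmem k) h2
        rw [hprof, max_eq_right hρ0.le, hshift] at h3
        have h4 := hineq (k + 1) hk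
        have h5 : h * χ (k + 1) ≤ h * 1 := mul_le_mul_of_nonneg_left (hχI (k + 1)).2 hh
        have h6 : 0 ≤ h * σ (k + 1) := mul_nonneg hh hs.1
        simp only [hρ] at h3
        linarith
  have hXsum : ∀ k, X k = h * ∑ l ∈ Finset.range k, χ (l + 1) := by
    intro k
    induction k with
    | zero => simp [hX0]
    | succ k ih => rw [hXs, ih, Finset.sum_range_succ]; ring
  refine ⟨χ, hχ0, fun k _ => ?_, fun k _ => hχI k, fun k _ => (hmem k).2, fun k hk => ?_⟩
  · rcases k with _ | k
    · exact (hmem 0).2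
    · by_contra! hlt
      rcases le_or_gt (ρ (k + 1)) 0 with h0 | h0
      · rw [hzero _ (I1 _) h0] at hlt
        exact absurd (hχI (k + 1)).1 (not_le.2 hlt)
      · have h1 := S.strictMonoOn_profit (q (k + 1)) ⟨(hχI _).1, hlt.le.trans (hmem (k + 1)).2⟩
          (hmem (k + 1)) hlt
        rw [hprof, max_eq_right h0.le] at h1
        have h2 := hprof k
        have h3 := mul_nonneg hh (hχI (k + 1)).1
        rw [max_eq_right (by linarith [hρs k]), hshift] at h2
        linarith [hρs k]
  · rw [← hXsum]
    rcases k with _ | k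
    · rw [hX0, hχ0, ← conj, hC]
      rw [show S.conj (q 0) - 1 / α * S.conj (q 0) - ((1 - 1 / α) * S.conj (q 0) - 0) = 0 by ring,
        abs_zero]
      linarith
    · have h1 := hprof k
      rw [hshift] at h1
      have h2 := I2 k (by omega)
      have h3 := hY0 k (by omega)
      have h4 : 0 ≤ 1 / α * S.conj (q (k + 1)) := mul_nonneg hα'.le (S.conj_nonneg _)
      have h5 : S.profit (q (k + 1)) (χ (k + 1)) - 1 / α * S.conj (q (k + 1)) - (C - X (k + 1)) =
          max 0 (ρ k) - ρ k := by
        rw [hXs]; simp only [hρ] at h1 ⊢; linarith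
      rw [h5, abs_of_nonneg (sub_nonneg.2 (le_max_right _ _))]
      rcases le_total 0 (ρ k) with h6 | h6
      · rw [max_eq_right h6]; linarith
      · rw [max_eq_left h6]
        have h7 : ρ k = C + 1 / α * S.conj (q (k + 1)) - X k := rfl
        linarith

/-- The share of the profit at price `p` and utilization `y` that has to match the integral of the
utilization over the prices. -/
noncomputable def surplus (α p y : ℝ) : ℝ := S.profit p y - 1 / α * S.conj p

/-- Approximate solutions of the integrated differential equation: `ψ p` is a utilization and
`Q p` the price, close to `p`, to which it belongs. -/
structure IsApproxSolution (α η : ℝ) (ψ Q : ℝ → ℝ) : Prop where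
  price_mem : ∀ p ∈ Icc S.cLow S.pbar, Q p ∈ Icc p (p + η)
  mem : ∀ p ∈ Icc S.cLow S.pbar, ψ p ∈ Icc (0 : ℝ) 1
  le_supply : ∀ p ∈ Icc S.cLow S.pbar, ψ p ≤ S.supply (Q p + η)
  right : ψ S.pbar = S.supply S.pbar
  mono : MonotoneOn ψ (Icc S.cLow S.pbar)
  surplus_mem : ∀ p ∈ Icc S.cLow S.pbar, ∀ p' ∈ Icc S.cLow S.pbar, p ≤ p' →
    S.surplus α (Q p') (ψ p') - S.surplus α (Q p) (ψ p) ∈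
      Icc ((Q p' - Q p) * ψ p - η) ((Q p' - Q p) * ψ p' + η)

variable {S}

theorem exists_isApproxSolution [Fintype K] {α η : ℝ} (hα : 1 ≤ α)
    (hS : S.HasSingleResourceBundle) {A : S.OnlineAlgorithm} (hA : S.IsCompetitive α A.run)
    (hη : 0 < η) : ∃ ψ Q, S.IsApproxSolution α η ψ Q := by
  have hα0 : 0 < α := by linarith
  have hw : 0 < S.pbar - S.cLow := sub_pos.2 S.cLow_lt_pbar
  -- Mesh and sales error are each at most `η / 4`; a difference of two surplus values, each off by
  -- `h + δ`, is then within `η`.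
  obtain ⟨m, hm⟩ := exists_nat_gt ((S.pbar - S.cLow) / (η / 4))
  have hm0 : (0 : ℝ) < m := lt_trans (by positivity) hm
  set h := (S.pbar - S.cLow) / m with hh
  have hh0 : 0 < h := by positivity
  have hhη : h < η / 4 := by
    rw [div_lt_iff₀ (by positivity)] at hm
    rw [hh, div_lt_iff₀ hm0]; linarith
  have hmh : m * h = S.pbar - S.cLow := by rw [hh]; field_simp
  let p : ℕ → ℝ := fun i => S.cLow + i * h
  let q : ℕ → ℝ := fun k => S.pbar - k * h
  have hqp : ∀ k ≤ m, q k = p (m - k) := fun k hk => by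
    simp only [p, q, Nat.cast_sub hk]; linarith
  obtain ⟨s, hs⟩ := exists_sales_of_isCompetitive hα hS hA (m := m) (p := p) (h := h)
    (δ := η / 4) (fun i => by simp only [p]; push_cast; ring)
    (fun i _ => add_nonneg S.cLow_nonneg (by positivity))
    (fun i hi => by
      have : (i : ℝ) * h ≤ m * h := by gcongr
      simp only [p]; linarith) (by positivity)
  obtain ⟨χ, hχ0, hχanti, hχI, hχs, hχe⟩ := S.exists_backward_scheme (m := m) (q := q)
    (σ := fun k => s (m - k)) (Y := fun k => h * ∑ j ∈ Finset.range (m - k), s j) hα0 hh0.le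
    (by positivity : 0 ≤ η / 4) (fun k => by simp only [q]; push_cast; ring)
    (fun k hk => by
      rw [show m - k = m - (k + 1) + 1 by omega, Finset.sum_range_succ]; ring)
    (fun k hk => mul_nonneg hh0.le (Finset.sum_nonneg fun j hj =>
      (hs j (by have := Finset.mem_range.1 hj; omega)).1.1))
    (fun k _ => (hs _ (by omega)).1)
    (fun k hk => by rw [hqp k hk]; exact (hs _ (by omega)).2)
  have hanti : ∀ k k', k' ≤ k → k ≤ m → χ k ≤ χ k' := by
    intro k k' hkk
    induction k, hkk using Nat.le_induction with
    | base => intro _; exact le_rfl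
    | succ k _ ih => intro hk; exact (hχanti k hk).trans (ih (by omega))
  let κ : ℝ → ℕ := fun x => ⌊(S.pbar - x) / h⌋₊
  have hκle : ∀ x ∈ Icc S.cLow S.pbar, κ x ≤ m := fun x hx => by
    refine Nat.floor_le_of_le ?_
    rw [div_le_iff₀ hh0, hmh]; linarith [hx.1]
  have hκanti : ∀ x x', x ≤ x' → κ x' ≤ κ x := fun x x' hxx =>
    Nat.floor_le_floor (div_le_div_of_nonneg_right (by linarith) hh0.le)
  have hκ0 : κ S.pbar = 0 := by simp [κ]
  have hq0 : q 0 = S.pbar := by simp [q]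
  refine ⟨fun x => χ (κ x), fun x => q (κ x), ?_, fun x hx => hχI _ (hκle x hx), ?_, ?_, ?_, ?_⟩
  · intro x hx
    have h1 := (le_div_iff₀ hh0).1 (Nat.floor_le (div_nonneg (sub_nonneg.2 hx.2) hh0.le))
    have h2 := (div_lt_iff₀ hh0).1 (Nat.lt_floor_add_one ((S.pbar - x) / h))
    simp only [q, κ]
    constructor <;> linarith
  · intro x hx
    have hx' := hκle x hx
    rcases hk : κ x with _ | k
    · rw [hχ0]; exact S.monotone_supply (by linarith)
    · refine (hχs k (by omega)).trans (S.monotone_supply ?_)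
      simp only [q]; push_cast; linarith
  · rw [hκ0, hχ0, hq0]
  · intro x hx x' hx' hxx
    exact hanti _ _ (hκanti x x' hxx) (hκle x hx)
  · intro x hx x' hx' hxx
    have hk := hκle x hx
    have hkk := hκanti x x' hxx
    generalize κ x = k at *
    generalize κ x' = k' at *
    have e1 := abs_le.1 (hχe k hk)
    have e2 := abs_le.1 (hχe k' (hkk.trans hk))
    have hsplit := Finset.sum_range_add_sum_Ico (fun l => χ (l + 1)) hkk
    have hcard : ((Finset.Ico k' k).card : ℝ) = k - k' := by
      rw [Nat.card_Ico, Nat.cast_sub hkk]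
    have hlow : (k - k' : ℝ) * χ k ≤ ∑ l ∈ Finset.Ico k' k, χ (l + 1) := by
      rw [← hcard, ← nsmul_eq_mul]
      refine Finset.card_nsmul_le_sum _ _ _ fun l hl => ?_
      have := Finset.mem_Ico.1 hl
      exact hanti _ _ (by omega) hk
    have hup : ∑ l ∈ Finset.Ico k' k, χ (l + 1) ≤ (k - k' : ℝ) * χ k' := by
      rw [← hcard, ← nsmul_eq_mul]
      refine Finset.sum_le_card_nsmul _ _ _ fun l hl => ?_
      have := Finset.mem_Ico.1 hl
      exact hanti _ _ (by omega) (by omega)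
    have h1 := mul_le_mul_of_nonneg_left hlow hh0.le
    have h2 := mul_le_mul_of_nonneg_left hup hh0.le
    have h3 : q k' - q k = h * (k - k') := by simp only [q]; ring
    rw [← hsplit, mul_add] at e1
    simp only [surplus]
    rw [h3, mul_assoc, mul_assoc]
    constructor <;> linarith [e1.1, e1.2, e2.1, e2.2]

end Setup

/-! ### Passage to the limit. -/

theorem Ultrafilter.exists_tendsto_Icc {ι : Type*} (U : Ultrafilter ι) {Y : ι → ℝ} {a b : ℝ}
    (hY : ∀ᶠ i in U, Y i ∈ Icc a b) : ∃ y ∈ Icc a b, Tendsto Y U (𝓝 y) :=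
  isCompact_Icc.ultrafilter_le_nhds (U.map Y) (le_principal_iff.2 hY)

namespace Setup

variable {K : Type*} {S : Setup K}

theorem tendsto_profit (S : Setup K) {ι : Type*} {l : Filter ι} {P Y : ι → ℝ} {p y : ℝ}
    (hP : Tendsto P l (𝓝 p)) (hY : Tendsto Y l (𝓝 y)) (hYI : ∀ᶠ i in l, Y i ∈ Icc (0 : ℝ) 1)
    (hy : y ∈ Icc (0 : ℝ) 1) : Tendsto (fun i => S.profit (P i) (Y i)) l (𝓝 (S.profit p y)) :=
  (hP.mul hY).sub ((S.continuousOn_f y hy).tendsto.comp (tendsto_nhdsWithin_iff.2 ⟨hY, hYI⟩))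

theorem tendsto_surplus (S : Setup K) (α : ℝ) {ι : Type*} {l : Filter ι} {P Y : ι → ℝ} {p y : ℝ}
    (hP : Tendsto P l (𝓝 p)) (hY : Tendsto Y l (𝓝 y)) (hYI : ∀ᶠ i in l, Y i ∈ Icc (0 : ℝ) 1)
    (hy : y ∈ Icc (0 : ℝ) 1) :
    Tendsto (fun i => S.surplus α (P i) (Y i)) l (𝓝 (S.surplus α p y)) :=
  (S.tendsto_profit hP hY hYI hy).sub
    (((S.continuous_conj.tendsto p).comp hP).const_mul (1 / α))

variable (S) in
/-- Solutions of the integrated differential equation for the inverse of the pricing function,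
ending at the maximal utilization. -/
structure IsIntegralSolution (α : ℝ) (ψ : ℝ → ℝ) : Prop where
  mem : ∀ p ∈ Icc S.cLow S.pbar, ψ p ∈ Icc 0 (S.supply p)
  right : ψ S.pbar = S.supply S.pbar
  mono : MonotoneOn ψ (Icc S.cLow S.pbar)
  surplus_mem : ∀ p ∈ Icc S.cLow S.pbar, ∀ p' ∈ Icc S.cLow S.pbar, p ≤ p' →
    S.surplus α p' (ψ p') - S.surplus α p (ψ p) ∈ Icc ((p' - p) * ψ p) ((p' - p) * ψ p')

theorem exists_isIntegralSolution {α : ℝ}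
    (H : ∀ η > 0, ∃ ψ Q, S.IsApproxSolution α η ψ Q) : ∃ ψ, S.IsIntegralSolution α ψ := by
  choose ψ Q hψ using fun n : ℕ => H (1 / ((n : ℝ) + 1)) (by positivity)
  -- Limits along one ultrafilter exist at all prices simultaneously, in place of Helly's selection
  -- theorem.
  let U : Ultrafilter ℕ := hyperfilter ℕ
  have hη : Tendsto (fun n : ℕ => 1 / ((n : ℝ) + 1)) U (𝓝 0) :=
    tendsto_one_div_add_atTop_nhds_zero_nat.mono_left Nat.hyperfilter_le_atTop
  have hlim : ∀ p, ∃ y, p ∈ Icc S.cLow S.pbar →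
      y ∈ Icc (0 : ℝ) 1 ∧ Tendsto (fun n => ψ n p) U (𝓝 y) := by
    intro p
    by_cases hp : p ∈ Icc S.cLow S.pbar
    · obtain ⟨y, hy, hy'⟩ := U.exists_tendsto_Icc (Y := fun n => ψ n p)
        (Eventually.of_forall fun n => (hψ n).mem p hp)
      exact ⟨y, fun _ => ⟨hy, hy'⟩⟩
    · exact ⟨0, fun h => absurd h hp⟩
  choose χ hχ using hlim
  have hQ : ∀ p ∈ Icc S.cLow S.pbar, Tendsto (fun n => Q n p) U (𝓝 p) := by
    intro p hp
    refine tendsto_of_tendsto_of_tendsto_of_le_of_le tendsto_const_nhds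
      (h := fun n : ℕ => p + 1 / ((n : ℝ) + 1)) ?_ (fun n => ((hψ n).price_mem p hp).1)
      (fun n => ((hψ n).price_mem p hp).2)
    simpa using hη.const_add p
  have hsur : ∀ p ∈ Icc S.cLow S.pbar,
      Tendsto (fun n => S.surplus α (Q n p) (ψ n p)) U (𝓝 (S.surplus α p (χ p))) := fun p hp =>
    S.tendsto_surplus α (hQ p hp) (hχ p hp).2
      (Eventually.of_forall fun n => (hψ n).mem p hp) (hχ p hp).1
  refine ⟨χ, fun p hp => ⟨(hχ p hp).1.1, ?_⟩, ?_, ?_, ?_⟩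
  · have h1 : Tendsto (fun n : ℕ => S.supply (Q n p + 1 / ((n : ℝ) + 1))) U
        (𝓝 (S.supply (p + 0))) :=
      (S.continuous_supply.tendsto _).comp ((hQ p hp).add hη)
    rw [add_zero] at h1
    exact le_of_tendsto_of_tendsto' (hχ p hp).2 h1 fun n => (hψ n).le_supply p hp
  · refine tendsto_nhds_unique (hχ _ (right_mem_Icc.2 S.cLow_lt_pbar.le)).2 ?_
    simp only [(hψ _).right]
    exact tendsto_const_nhds
  · intro p hp p' hp' hpp
    exact le_of_tendsto_of_tendsto' (hχ p hp).2 (hχ p' hp').2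
      fun n => (hψ n).mono hp hp' hpp
  · intro p hp p' hp' hpp
    have h1 := (hsur p' hp').sub (hsur p hp)
    have h2 : ∀ x ∈ Icc S.cLow S.pbar,
        Tendsto (fun n => (Q n p' - Q n p) * ψ n x) U (𝓝 ((p' - p) * χ x)) := fun x hx =>
      ((hQ p' hp').sub (hQ p hp)).mul (hχ x hx).2
    constructor
    · have := (h2 p hp).sub hη
      rw [sub_zero] at this
      exact le_of_tendsto_of_tendsto' this h1 fun n => ((hψ n).surplus_mem p hp p' hp' hpp).1
    · have := (h2 p' hp').add hη
      rw [add_zero] at this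
      exact le_of_tendsto_of_tendsto' h1 this fun n => ((hψ n).surplus_mem p hp p' hp' hpp).2

/-! ### Regularity of integral solutions and their inversion. -/

namespace IsIntegralSolution

variable {α : ℝ} {ψ : ℝ → ℝ}

theorem mem_Icc_one (h : S.IsIntegralSolution α ψ) {p : ℝ} (hp : p ∈ Icc S.cLow S.pbar) :
    ψ p ∈ Icc (0 : ℝ) 1 :=
  ⟨(h.mem p hp).1, (h.mem p hp).2.trans (S.supply_mem p).2⟩

theorem left (h : S.IsIntegralSolution α ψ) : ψ S.cLow = 0 := by
  have := h.mem _ (left_mem_Icc.2 S.cLow_lt_pbar.le)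
  rw [S.supply_cLow] at this
  exact le_antisymm this.2 this.1

theorem surplus_left (h : S.IsIntegralSolution α ψ) : S.surplus α S.cLow (ψ S.cLow) = 0 := by
  rw [h.left, surplus, S.profit_zero, S.conj_cLow]; ring

theorem pos (h : S.IsIntegralSolution α ψ) (hα : 0 < α) {p : ℝ} (hp : p ∈ Ioc S.cLow S.pbar) :
    0 < ψ p := by
  have hp' := Ioc_subset_Icc_self hp
  refine lt_of_le_of_ne (h.mem p hp').1 fun h0 => ?_
  have h1 := (h.surplus_mem _ (left_mem_Icc.2 S.cLow_lt_pbar.le) p hp' hp.1.le).1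
  rw [h.surplus_left, h.left, ← h0, surplus, S.profit_zero] at h1
  have := mul_pos (one_div_pos.2 hα) (S.conj_pos hp.1)
  linarith

/-- If `ψ p` reached the supply, the surplus would be at its maximum `(1 - 1 / α) * conj p`. To the
right of `p` it would have to grow at rate at least `supply p`, but its maximum grows only at rate
`(1 - 1 / α) * supply p`. -/
theorem lt_supply (h : S.IsIntegralSolution α ψ) (hα : 1 ≤ α) {p : ℝ}
    (hp : p ∈ Ioo S.cLow S.pbar) : ψ p < S.supply p := by
  have hp' := Ioo_subset_Icc_self hp
  refine lt_of_le_of_ne (h.mem p hp').2 fun heq => ?_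
  have hα0 : 0 < 1 / α := by positivity
  have hα1 : 0 ≤ 1 - 1 / α := by
    rw [sub_nonneg, div_le_one (by linarith)]; exact hα
  have key : ∀ q ∈ Ioo p S.pbar, S.supply p ≤ (1 - 1 / α) * S.supply q := by
    intro q hq
    have hq' : q ∈ Icc S.cLow S.pbar := ⟨(hp.1.trans hq.1).le, hq.2.le⟩
    have h1 := (h.surplus_mem p hp' q hq' hq.1.le).1
    have h2 := S.profit_le_conj q (h.mem_Icc_one hq')
    have h3 := mul_le_mul_of_nonneg_left (S.conj_sub_le_mul_supply p q) hα1
    rw [heq, surplus, surplus, ← conj] at h1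
    have h4 : 0 < q - p := sub_pos.2 hq.1
    refine le_of_mul_le_mul_left ?_ h4
    linarith
  have hlim : Tendsto (fun q => (1 - 1 / α) * S.supply q) (𝓝[>] p)
      (𝓝 ((1 - 1 / α) * S.supply p)) :=
    ((S.continuous_supply.tendsto p).mono_left nhdsWithin_le_nhds).const_mul _
  have hle := ge_of_tendsto hlim (by
    filter_upwards [Ioo_mem_nhdsGT hp.2] with q hq using key q hq)
  have := mul_pos hα0 (S.supply_pos hp.1)
  linarith

theorem abs_surplus_sub_le (h : S.IsIntegralSolution α ψ) {p p' : ℝ}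
    (hp : p ∈ Icc S.cLow S.pbar) (hp' : p' ∈ Icc S.cLow S.pbar) :
    |S.surplus α p' (ψ p') - S.surplus α p (ψ p)| ≤ |p' - p| := by
  wlog hpp : p ≤ p' generalizing p p'
  · rw [abs_sub_comm, abs_sub_comm p' p]
    exact this hp' hp (le_of_not_ge hpp)
  obtain ⟨h1, h2⟩ := h.surplus_mem p hp p' hp' hpp
  have h3 := sub_nonneg.2 hpp
  rw [abs_of_nonneg h3, abs_of_nonneg ((mul_nonneg h3 (h.mem p hp).1).trans h1)]
  exact h2.trans (mul_le_of_le_one_right h3 (h.mem_Icc_one hp').2)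

/-- The surplus is Lipschitz along `ψ`, and it determines the utilization because profit is
injective up to the supply; hence every ultrafilter limit of `ψ` is the value. -/
theorem continuousOn (h : S.IsIntegralSolution α ψ) : ContinuousOn ψ (Icc S.cLow S.pbar) := by
  intro p hp
  refine (tendsto_iff_ultrafilter _ _ _).2 fun U hU => ?_
  obtain ⟨hUp, hUI⟩ := tendsto_nhdsWithin_iff.1 (show Tendsto id (U : Filter ℝ) _ from hU)
  have hI : ∀ᶠ q in U, ψ q ∈ Icc (0 : ℝ) 1 := hUI.mono fun q hq => h.mem_Icc_one hq
  obtain ⟨y, hy, hlim⟩ := U.exists_tendsto_Icc hI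
  have h1 : Tendsto (fun q => S.surplus α q (ψ q)) U (𝓝 (S.surplus α p y)) :=
    S.tendsto_surplus α hUp hlim hI hy
  have h2 : Tendsto (fun q => S.surplus α q (ψ q)) U (𝓝 (S.surplus α p (ψ p))) := by
    rw [tendsto_iff_dist_tendsto_zero]
    refine squeeze_zero' (Eventually.of_forall fun _ => dist_nonneg)
      (hUI.mono fun q hq => h.abs_surplus_sub_le hp hq) ?_
    exact tendsto_iff_dist_tendsto_zero.1 hUp
  have h3 : y ≤ S.supply p := le_of_tendsto_of_tendsto hlim
    ((S.continuous_supply.tendsto p).comp hUp) (hUI.mono fun q hq => (h.mem q hq).2)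
  have h4 := tendsto_nhds_unique h1 h2
  rw [surplus, surplus, sub_left_inj] at h4
  rwa [← (S.strictMonoOn_profit p).injOn ⟨hy.1, h3⟩ (h.mem p hp) h4]

theorem hasDerivAt_surplus (h : S.IsIntegralSolution α ψ) {p : ℝ}
    (hp : p ∈ Ioo S.cLow S.pbar) : HasDerivAt (fun q => S.surplus α q (ψ q)) (ψ p) p := by
  have hp' := Ioo_subset_Icc_self hp
  have hc : Tendsto ψ (𝓝[≠] p) (𝓝 (ψ p)) :=
    ((h.continuousOn p hp').continuousAt (Icc_mem_nhds hp.1 hp.2)).tendsto.mono_left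
      nhdsWithin_le_nhds
  rw [hasDerivAt_iff_tendsto_slope, tendsto_iff_dist_tendsto_zero]
  refine squeeze_zero' (Eventually.of_forall fun _ => dist_nonneg) ?_
    (tendsto_iff_dist_tendsto_zero.1 hc)
  filter_upwards [self_mem_nhdsWithin, mem_nhdsWithin_of_mem_nhds (Icc_mem_nhds hp.1 hp.2)]
    with q hne hq
  rw [Real.dist_eq, Real.dist_eq, slope_def_field]
  rcases lt_or_gt_of_ne (show q ≠ p from hne) with hlt | hlt
  · obtain ⟨h1, h2⟩ := h.surplus_mem q hq p hp' hlt.le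
    have h3 := h.mono hq hp' hlt.le
    rw [abs_of_nonpos (sub_nonpos.2 h3), abs_of_nonpos, neg_le_neg_iff, sub_le_sub_iff_right,
      le_div_iff_of_neg (sub_neg.2 hlt)]
    · linarith
    · rw [sub_nonpos, div_le_iff_of_neg (sub_neg.2 hlt)]
      linarith
  · obtain ⟨h1, h2⟩ := h.surplus_mem p hp' q hq hlt.le
    have h3 := h.mono hp' hq hlt.le
    rw [abs_of_nonneg (sub_nonneg.2 h3), abs_of_nonneg, sub_le_sub_iff_right,
      div_le_iff₀ (sub_pos.2 hlt)]
    · linarith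
    · rw [sub_nonneg, le_div_iff₀ (sub_pos.2 hlt)]
      linarith

theorem hasDerivAt (h : S.IsIntegralSolution α ψ) (hα : 1 ≤ α) {p : ℝ}
    (hp : p ∈ Ioo S.cLow S.pbar) :
    HasDerivAt ψ (1 / α * S.supply p / (p - S.marginal (ψ p))) p := by
  have hp' := Ioo_subset_Icc_self hp
  have hlt := h.lt_supply hα hp
  have hpos := h.pos (by linarith) (Ioo_subset_Ioc_self hp)
  have hψI : ψ p ∈ Ioo (0 : ℝ) 1 := ⟨hpos, hlt.trans_le (S.supply_mem p).2⟩
  have hm := S.marginal_lt_of_lt_supply hpos.le hlt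
  have hc : Tendsto ψ (𝓝[≠] p) (𝓝 (ψ p)) :=
    ((h.continuousOn p hp').continuousAt (Icc_mem_nhds hp.1 hp.2)).tendsto.mono_left
      nhdsWithin_le_nhds
  have hf := S.hasDerivAt_marginal hψI
  -- The increment of `profit q (ψ q)` splits into `(q - p) * ψ q` and the increment of `ψ` times `p
  -- - dslope S.f (ψ p) (ψ q)`. That factor has a positive limit, so it can be divided out; `dslope`
  -- also covers `ψ q = ψ p`.
  have hds : Tendsto (fun q => p - dslope S.f (ψ p) (ψ q)) (𝓝[≠] p)
      (𝓝 (p - S.marginal (ψ p))) := by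
    have := (continuousAt_dslope_same.2 hf.differentiableAt).tendsto.comp hc
    rw [dslope_same, hf.deriv] at this
    exact this.const_sub p
  have hR : HasDerivAt (fun q => S.profit q (ψ q)) (ψ p + 1 / α * S.supply p) p := by
    have := (h.hasDerivAt_surplus hp).add ((S.hasDerivAt_conj p).const_mul (1 / α))
    refine this.congr_of_eventuallyEq (Eventually.of_forall fun q => ?_)
    simp [surplus]
  rw [hasDerivAt_iff_tendsto_slope] at hR ⊢
  have hlim := (hR.sub hc).div hds (sub_pos.2 hm).ne'
  rw [add_sub_cancel_left] at hlim
  refine hlim.congr' ?_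
  filter_upwards [self_mem_nhdsWithin, hds.eventually_ne (sub_pos.2 hm).ne'] with q hne hq
  have hqp : q - p ≠ 0 := sub_ne_zero.2 hne
  have hd := sub_smul_dslope S.f (ψ p) (ψ q)
  rw [smul_eq_mul] at hd
  simp only [Pi.div_apply, slope_def_field, profit]
  rw [div_eq_div_iff hq hqp, sub_mul, div_mul_cancel₀ _ hqp]
  linarith

theorem strictMonoOn (h : S.IsIntegralSolution α ψ) (hα : 1 ≤ α) :
    StrictMonoOn ψ (Icc S.cLow S.pbar) := by
  refine strictMonoOn_of_deriv_pos (convex_Icc _ _) h.continuousOn fun p hp => ?_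
  rw [interior_Icc] at hp
  rw [(h.hasDerivAt hα hp).deriv]
  have hpos := h.pos (by linarith) (Ioo_subset_Ioc_self hp)
  have hm := S.marginal_lt_of_lt_supply hpos.le (h.lt_supply hα hp)
  exact div_pos (mul_pos (by positivity) (S.supply_pos hp.1)) (sub_pos.2 hm)

theorem exists_pricing (h : S.IsIntegralSolution α ψ) (hα : 1 ≤ α) :
    ∃ φ : ℝ → ℝ, StrictMonoOn φ (Icc 0 1) ∧ ContinuousOn φ (Icc 0 (S.supply S.pbar)) ∧
      φ 0 = S.cLow ∧ φ (S.supply S.pbar) = S.pbar ∧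
      ∀ y ∈ Ioo 0 (S.supply S.pbar),
        HasDerivAt φ (α * ((φ y - S.marginal y) / S.supply (φ y))) y := by
  have hab := S.cLow_lt_pbar.le
  have hsurj := intermediate_value_Icc hab h.continuousOn
  obtain ⟨hmono, hcont, hinv, hinv'⟩ := (h.strictMonoOn hα).invFunOn_Icc hab hsurj
  have h0 := hinv' _ (left_mem_Icc.2 hab)
  have h1 := hinv' _ (right_mem_Icc.2 hab)
  rw [h.left, h.right] at hmono hcont hinv
  rw [h.left] at h0
  rw [h.right] at h1
  set v := S.supply S.pbar with hv
  have hvI : v ∈ Icc (0 : ℝ) 1 := S.supply_mem S.pbar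
  set g := Function.invFunOn ψ (Icc S.cLow S.pbar) with hg
  -- Past `v` any strictly increasing continuation would do.
  let φ : ℝ → ℝ := fun y => if y ≤ v then g y else S.pbar + (y - v)
  have hφg : ∀ y ≤ v, φ y = g y := fun y hy => if_pos hy
  have hφc : ContinuousOn φ (Icc 0 v) := hcont.congr fun y hy => hφg y hy.2
  have hφm : StrictMonoOn φ (Icc 0 v) := hmono.congr fun y hy => (hφg y hy.2).symm
  refine ⟨φ, ?_, hφc, by rw [hφg 0 hvI.1, h0], by rw [hφg v le_rfl, h1], fun y hy => ?_⟩
  · have hφm' : StrictMonoOn φ (Icc v 1) := by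
      have : StrictMonoOn (fun y => S.pbar + (y - v)) (Icc v 1) := fun x _ y _ hxy => by
        simp only; linarith
      refine this.congr fun y hy => ?_
      rcases hy.1.eq_or_lt with rfl | hlt
      · simp [hφg, h1]
      · exact (if_neg (not_le.2 hlt)).symm
    have := hφm.union hφm' (isGreatest_Icc hvI.1) (isLeast_Icc hvI.2)
    rwa [Icc_union_Icc_eq_Icc hvI.1 hvI.2] at this
  · have hyI := Ioo_subset_Icc_self hy
    have hyφ : φ y = g y := hφg y hy.2.le
    obtain ⟨hgm, hgy⟩ := hinv y hyI
    rw [← hyφ] at hgm hgy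
    have hlo : S.cLow < φ y := lt_of_le_of_ne hgm.1 fun he => by
      rw [← he, h.left] at hgy
      exact hy.1.ne hgy
    have hhi : φ y < S.pbar := lt_of_le_of_ne hgm.2 fun he => by
      rw [he, h.right] at hgy
      exact hy.2.ne hgy.symm
    have hd := h.hasDerivAt hα ⟨hlo, hhi⟩
    have hm := S.marginal_lt_of_lt_supply (h.mem _ hgm).1 (h.lt_supply hα ⟨hlo, hhi⟩)
    rw [hgy] at hd hm
    have hs := S.supply_pos hlo
    have hm' := sub_pos.2 hm
    have hα0 : 0 < α := by linarith
    have hne : 1 / α * S.supply (φ y) / (φ y - S.marginal y) ≠ 0 := by positivity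
    refine (HasDerivAt.of_local_left_inverse
      ((hφc y hyI).continuousAt (Icc_mem_nhds hy.1 hy.2)) hd hne ?_).congr_deriv ?_
    · filter_upwards [Icc_mem_nhds hy.1 hy.2] with z hz
      rw [hφg z hz.2]
      exact (hinv z hz).2
    · field_simp

end IsIntegralSolution

/-- With `supply` instead of `f'⁻¹` no distinction between low and high uncertainty is needed; the
cases differ only in whether `φ` crosses `cHigh` before reaching `pbar`. -/
theorem exists_pricing_of_isCompetitive [Fintype K] {α : ℝ} (hα : 1 ≤ α)
    (hS : S.HasSingleResourceBundle) {A : S.OnlineAlgorithm} (hA : S.IsCompetitive α A.run) :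
    ∃ φ : ℝ → ℝ, StrictMonoOn φ (Icc 0 1) ∧ ContinuousOn φ (Icc 0 (S.supply S.pbar)) ∧
      φ 0 = S.cLow ∧ φ (S.supply S.pbar) = S.pbar ∧
      ∀ y ∈ Ioo 0 (S.supply S.pbar),
        HasDerivAt φ (α * ((φ y - S.marginal y) / S.supply (φ y))) y := by
  obtain ⟨ψ, hψ⟩ := exists_isIntegralSolution (S := S) (α := α)
    fun η hη => exists_isApproxSolution hα hS hA hη
  exact hψ.exists_pricing hα

theorem exists_solvesL [Fintype K] {α : ℝ} (hα : 1 ≤ α) (hlow : S.pbar ≤ S.cHigh)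
    (hS : S.HasSingleResourceBundle) {A : S.OnlineAlgorithm} (hA : S.IsCompetitive α A.run) :
    ∃ φ : ℝ → ℝ, StrictMonoOn φ (Icc 0 1) ∧ S.SolvesL α φ ∧
      ∀ y ∈ Ioo 0 (S.marginalInv S.pbar), φ y ≤ S.cHigh := by
  obtain ⟨φ, hm, hc, h0, h1, hd⟩ := exists_pricing_of_isCompetitive hα hS hA
  have hv := S.supply_mem S.pbar
  rw [S.supply_eq ⟨S.cLow_lt_pbar.le, hlow⟩] at *
  have hI : ∀ y ∈ Ioo 0 (S.marginalInv S.pbar), y ∈ Icc (0 : ℝ) 1 := fun y hy =>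
    ⟨hy.1.le, hy.2.le.trans hv.2⟩
  have hlo : ∀ y ∈ Ioo 0 (S.marginalInv S.pbar), S.cLow < φ y := fun y hy => by
    rw [← h0]; exact hm zero_mem (hI y hy) hy.1
  have hhi : ∀ y ∈ Ioo 0 (S.marginalInv S.pbar), φ y ≤ S.cHigh := fun y hy =>
    (hm (hI y hy) hv hy.2).le.trans (h1.le.trans hlow)
  refine ⟨φ, hm, ⟨hc, hlo, fun y hy _ => ?_, h0, h1.ge⟩, hhi⟩
  rw [← S.supply_eq ⟨(hlo y hy).le, hhi y hy⟩]
  exact hd y hy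

theorem exists_solvesH [Fintype K] {α : ℝ} (hα : 1 ≤ α) (hhigh : S.cHigh < S.pbar)
    (hS : S.HasSingleResourceBundle) {A : S.OnlineAlgorithm} (hA : S.IsCompetitive α A.run) :
    ∃ u ∈ Ioo (0 : ℝ) 1, ∃ φ : ℝ → ℝ, StrictMonoOn φ (Icc 0 1) ∧
      S.SolvesH1 u α φ ∧ S.SolvesH2 u α φ := by
  obtain ⟨φ, hm, hc, h0, h1, hd⟩ := exists_pricing_of_isCompetitive hα hS hA
  rw [S.supply_of_cHigh_le hhigh.le] at *
  obtain ⟨u, hu, hφu⟩ := intermediate_value_Ioo zero_le_one hc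
    (show S.cHigh ∈ Ioo (φ 0) (φ 1) by rw [h0, h1]; exact ⟨S.cLow_lt_cHigh, hhigh⟩)
  have huI := Ioo_subset_Icc_self hu
  have hrange : ∀ y ∈ Ioo 0 u, φ y ∈ Ioc S.cLow S.cHigh := fun y hy => by
    have hyI : y ∈ Icc (0 : ℝ) 1 := ⟨hy.1.le, (hy.2.trans hu.2).le⟩
    rw [← h0, ← hφu]
    exact ⟨hm zero_mem hyI hy.1, (hm hyI huI hy.2).le⟩
  refine ⟨u, hu, φ, hm,
    ⟨hc.mono (Icc_subset_Icc_right hu.2.le), hrange, fun y hy => ?_, h0, hφu⟩,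
    ⟨hc.mono (Icc_subset_Icc_left hu.1.le), fun y hy => ?_, hφu, h1.ge⟩⟩
  · rw [← S.supply_eq (Ioc_subset_Icc_self (hrange y hy))]
    exact hd y ⟨hy.1, hy.2.trans hu.2⟩
  · have hyI : y ∈ Ioo (0 : ℝ) 1 := ⟨hu.1.trans hy.1, hy.2⟩
    have h2 := hd y hyI
    rwa [S.supply_of_cHigh_le (by
      rw [← hφu]; exact (hm huI (Ioo_subset_Icc_self hyI) hy.1).le), div_one] at h2

end Setup

end

theorem theorem1 {K : Type*} [Fintype K] (S : Setup K) (α : ℝ) (hα : 1 ≤ α) :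
    -- low-uncertainty case
    (S.pbar ≤ S.cHigh →
      (∀ φ : ℝ → ℝ, StrictMonoOn φ (Set.Icc 0 1) → S.SolvesL α φ →
        S.IsCompetitive α (S.PPM φ)) ∧
      (S.HasSingleResourceBundle →
        (∃ A : S.OnlineAlgorithm, S.IsCompetitive α A.run) →
        ∃ φ : ℝ → ℝ, StrictMonoOn φ (Set.Icc 0 1) ∧ S.SolvesL α φ ∧
          ∀ y ∈ Set.Ioo 0 (S.marginalInv S.pbar), φ y ≤ S.cHigh)) ∧
    -- high-uncertainty case
    (S.cHigh < S.pbar →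
      (∀ (u : ℝ) (φ : ℝ → ℝ), u ∈ Set.Ioo (0 : ℝ) 1 → S.SolvesH1 u α φ → S.SolvesH2 u α φ →
        S.IsCompetitive α (S.PPM φ)) ∧
      (S.HasSingleResourceBundle →
        (∃ A : S.OnlineAlgorithm, S.IsCompetitive α A.run) →
        ∃ u ∈ Set.Ioo (0 : ℝ) 1, ∃ φ : ℝ → ℝ, StrictMonoOn φ (Set.Icc 0 1) ∧
          S.SolvesH1 u α φ ∧ S.SolvesH2 u α φ)) := by
  exact ⟨fun hlow => ⟨fun _ hφ h => h.isCompetitive hα hlow hφ,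
      fun hS ⟨_, hA⟩ => Setup.exists_solvesL hα hlow hS hA⟩,
    fun hhigh => ⟨fun _ _ hu h1 h2 => h1.isCompetitive hα hhigh hu h2,
      fun hS ⟨_, hA⟩ => Setup.exists_solvesH hα hhigh hS hA⟩⟩
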